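/- **Setting.** $\mathbb N=\{1,2,\dots\}$. $\beta\mathbb N$ is the space of ultrafilters on $\mathbb N$, $\mathbb N^*=\beta\mathbb N\setminus\mathbb N$, and $\tau:\beta\mathbb N\to\beta\mathbb N$ is the continuous extension of $n\mapsto n+1$; it restricts to a homeomorphism of $\mathbb N^*$. $\Omega$ is the quotient of $\beta\mathbb N\times[0,1]$ that identifies $(\eta,1)$ with $(\tau\eta,0)$, and $\Omega^*\subset\Omega$ is the closed subspace of the points $(\eta,t)$ with $\eta\in\mathbb N^*$. It carries the flow $\tau^s(\eta,t)=(\tau^{[t+s]}\eta,\;t+s-[t+s])$, $s\in\mathbb R$. A point $\omega=(\eta,t)$ is also regarded as the ultrafilter on $[1,\infty)$ generated by the sets $A+t$, $A\in\eta$. $\mathcal M$ is the set of linear functionals $\psi$ on $L^\infty([1,\infty))$ (real-valued) with $\psi(f)\le\limsup_{x\to\infty}\frac1x\int_1^x f(t)\,dt$ for all $f$, with the weak* topology. $\tilde{\mathcal M}\subset\mathcal M$ is the set of functionals $\psi^{\mathcal U}(f)=\mathcal U\text{-}\lim_x\frac1x\int_1^xf(t)\,dt$, where $\mathcal U$ is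 an ultrafilter on $[1,\infty)$ that contains no bounded set. For $\omega\in\Omega^*$ put $\Psi(\omega)=\psi_\omega$, $\psi_\omega(f)=\omega\text{-}\lim_x 2^{-x}\int_1^{2^x}f(t)\,dt$. $P(\Omega^*)$ is the set of regular Borel probability measures on $\Omega^*$, with the weak* topology. For $s\ge0$ let $(T_sf)(x)=f(x+s)$ on the space $C_{ub}([1,\infty))$ of bounded uniformly continuous real functions, and $(P_sf)(x)=f(2^sx)$ on $L^\infty([1,\infty))$. For $f\in C_{ub}([1,\infty))$ write $\bar f(\omega)=\omega\text{-}\lim_xf(x)$; a measure $\mu\in P(\Omega^*)$ is regarded as the functional $f\mapsto\int_{\Omega^*}\bar f\,d\mu$ on $C_{ub}([1,\infty))$. **Theorem 4.4.** 1. There is exactly one continuous flow $\{T_s^*\}_{s\in\mathbb R}$ on $P(\Omega^*)$ that for $s\ge0$ is given by the adjoint of $T_s$, i.e. $\int\bar f\,d(T_s^*\mu)=\int\overline{T_sf}\,d\mu$ for all $f\in C_{ub}([1,\infty))$; and exactly one continuous flow $\{P_s^*\}_{s\in\mathbb R}$ on $\mathcal M$ that for $s\ge0$ is given by the adjoint of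 $P_s$, i.e. $(P_s^*\psi)(f)=\psi(P_sf)$ for all $f\in L^\infty([1,\infty))$. (A continuous flow is a jointly continuous action of $(\mathbb R,+)$.) 2. The formula $\overline\Psi(\mu)(f)=\int_{\Omega^*}\psi_\omega(f)\,d\mu(\omega)$, in which the integrand is $\mu$-integrable, defines an affine homeomorphism $\overline\Psi$ of the convex set $P(\Omega^*)$ onto $\mathcal M$, and $$\overline\Psi\circ T_s^*=P_s^*\circ\overline\Psi\qquad\text{for every } s\in\mathbb R .$$ 3. For every $\omega\in\Omega^*$ one has $\delta_\omega\in P(\Omega^*)$, $\overline\Psi(\delta_\omega)=\psi_\omega$, and $T_s^*\delta_\omega=\delta_{\tau^s\omega}$ for every $s\in\mathbb R$. Moreover $\mathcal M$ is the closed convex hull of $\tilde{\mathcal M}$, and $P(\Omega^*)$ is the closed convex hull of $\{\delta_\omega:\omega\in\Omega^*\}$. Hence the continuous flows $(P(\Omega^*),\{T_s^*\}_{s\in\mathbb R})$ and $(\mathcal M,\{P_s^*\}_{s\in\mathbb R})$ on these closed convex hulls are isomorphic via $\overline\Psi$, which extends $\Psi$. -/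

import Mathlib

open MeasureTheory Filter Topology Set
open scoped ENNReal NNReal BoundedContinuousFunction

noncomputable section

namespace CesaroFlow

/-! ### The half line and its function spaces -/

/-- The half line `[1, ∞)`. -/
abbrev HalfLine : Type := Set.Ici (1 : ℝ)

/-- Lebesgue measure on `[1, ∞)`, as a measure on `ℝ`. -/
abbrev lebHalf : Measure ℝ := volume.restrict (Set.Ici (1 : ℝ))

/-- The real Banach space `L^∞([1, ∞))`. -/
abbrev LInf : Type := Lp ℝ ∞ lebHalf

theorem quasi_dilate (s : ℝ≥0) :
    Measure.QuasiMeasurePreserving (fun x : ℝ => (2 : ℝ) ^ (s : ℝ) * x) lebHalf lebHalf := by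
  have hc : (1 : ℝ) ≤ (2 : ℝ) ^ (s : ℝ) := Real.one_le_rpow (by norm_num) s.2
  have hc0 : (2 : ℝ) ^ (s : ℝ) ≠ 0 := by positivity
  refine ⟨measurable_const_mul _, ?_⟩
  refine Measure.AbsolutelyContinuous.mk fun N hN h0 => ?_
  rw [Measure.map_apply (measurable_const_mul _) hN,
    Measure.restrict_apply (measurable_const_mul _ hN)]
  rw [Measure.restrict_apply hN] at h0
  have hsub : (fun x : ℝ => (2 : ℝ) ^ (s : ℝ) * x) ⁻¹' N ∩ Set.Ici 1 ⊆
      (fun x : ℝ => (2 : ℝ) ^ (s : ℝ) * x) ⁻¹' (N ∩ Set.Ici 1) := by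
    rintro x ⟨hx, h1⟩
    refine ⟨hx, ?_⟩
    have h1' : (1 : ℝ) ≤ x := h1
    show (1 : ℝ) ≤ (2 : ℝ) ^ (s : ℝ) * x
    nlinarith
  refine measure_mono_null hsub ?_
  rw [Real.volume_preimage_mul_left hc0, h0, mul_zero]

theorem memLp_dilate (s : ℝ≥0) (f : LInf) :
    MemLp (fun x : ℝ => f ((2 : ℝ) ^ (s : ℝ) * x)) ∞ lebHalf := by
  have hq := quasi_dilate s
  refine ⟨(Lp.aestronglyMeasurable f).comp_quasiMeasurePreserving hq, ?_⟩
  refine lt_of_le_of_lt ?_ (Lp.memLp f).2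
  rw [eLpNorm_exponent_top, eLpNorm_exponent_top]
  refine essSup_le_of_ae_le _ ?_
  exact hq.ae (ae_le_eLpNormEssSup (f := (f : ℝ → ℝ)) (μ := lebHalf))

/-- The dilation operator `P_s`, `(P_s f)(x) = f (2 ^ s x)`, on `L^∞([1, ∞))`, for `s ≥ 0`. -/
def dilate (s : ℝ≥0) : LInf →ₗ[ℝ] LInf where
  toFun f := (memLp_dilate s f).toLp _
  map_add' f g := by
    have h := (quasi_dilate s).ae (Lp.coeFn_add f g)
    refine Lp.ext ?_
    filter_upwards [h, MemLp.coeFn_toLp (memLp_dilate s (f + g)),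
      Lp.coeFn_add ((memLp_dilate s f).toLp _) ((memLp_dilate s g).toLp _),
      MemLp.coeFn_toLp (memLp_dilate s f), MemLp.coeFn_toLp (memLp_dilate s g)]
      with x h1 h2 h3 h4 h5
    rw [h2, h3, Pi.add_apply, h4, h5, h1, Pi.add_apply]
  map_smul' c f := by
    have h := (quasi_dilate s).ae (Lp.coeFn_smul c f)
    refine Lp.ext ?_
    filter_upwards [h, MemLp.coeFn_toLp (memLp_dilate s (c • f)),
      Lp.coeFn_smul c ((memLp_dilate s f).toLp _),
      MemLp.coeFn_toLp (memLp_dilate s f)] with x h1 h2 h3 h4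
    simp only [RingHom.id_apply]
    rw [h2, h3, Pi.smul_apply, h4, h1, Pi.smul_apply]

/-- The mean `(U f)(x) = (1 / x) ∫_1^x f(t) dt`. -/
def mean (f : LInf) (x : ℝ) : ℝ := (1 / x) * ∫ t in (1 : ℝ)..x, f t

/-- The set `ℳ` of all linear functionals `ψ` on `L^∞([1, ∞))` with
`ψ f ≤ limsup_{x → ∞} (1 / x) ∫_1^x f(t) dt` for every `f`. It sits in the dual space of
`L^∞([1, ∞))` and carries the weak* topology. -/
def M : Set (WeakDual ℝ LInf) :=
  {ψ | ∀ f : LInf, ψ f ≤ limsup (mean f) atTop}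

/-- The space of bounded uniformly continuous real functions on `[1, ∞)`. -/
def Cub : Submodule ℝ (HalfLine →ᵇ ℝ) where
  carrier := {f | UniformContinuous f}
  add_mem' hf hg := UniformContinuous.add hf hg
  zero_mem' := uniformContinuous_const
  smul_mem' c _ hf := UniformContinuous.const_smul hf c

/-- The translation `x ↦ x + s` of `[1, ∞)`, for `s ≥ 0`. -/
def addHalf (s : ℝ≥0) (x : HalfLine) : HalfLine :=
  ⟨(x : ℝ) + s, le_add_of_le_of_nonneg x.2 s.2⟩

theorem uniformContinuous_addHalf (s : ℝ≥0) : UniformContinuous (addHalf s) :=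
  (uniformContinuous_subtype_val.add uniformContinuous_const).subtype_mk _

/-- The translation operator `T_s`, `(T_s f)(x) = f (x + s)`, for `s ≥ 0`. -/
def translate (s : ℝ≥0) : Cub →ₗ[ℝ] Cub where
  toFun f := ⟨f.1.compContinuous ⟨addHalf s, (uniformContinuous_addHalf s).continuous⟩,
    UniformContinuous.comp f.2 (uniformContinuous_addHalf s)⟩
  map_add' _ _ := rfl
  map_smul' _ _ := rfl

/-! ### Limits along ultrafilters -/

/-- The limit of a bounded real function `g` along the ultrafilter `𝒰`. -/
def ulim {X : Type*} (𝒰 : Ultrafilter X) (g : X → ℝ) : ℝ := limUnder (𝒰 : Filter X) g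

/-- The functional `ψ^𝒰(f) = 𝒰-lim_x (1 / x) ∫_1^x f(t) dt`. -/
def psiU (𝒰 : Ultrafilter HalfLine) (f : LInf) : ℝ := ulim 𝒰 fun x => mean f x

/-- The set of all functionals `ψ^𝒰`, where `𝒰` is an ultrafilter on `[1, ∞)` that contains
no bounded set. -/
def Mtilde : Set (WeakDual ℝ LInf) :=
  {ψ | ∃ 𝒰 : Ultrafilter HalfLine, (∀ B : Set HalfLine, Bornology.IsBounded B → B ∉ 𝒰) ∧
    ∀ f : LInf, ψ f = psiU 𝒰 f}

/-! ### The suspension of `(ℕ*, τ)`; here `ℕ = {1, 2, 3, …}` -/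

/-- The extension `τ : βℕ → βℕ` of `n ↦ n + 1`; the Stone-Čech compactification `βℕ` is the
space of ultrafilters on `ℕ`. -/
def tau (η : Ultrafilter ℕ+) : Ultrafilter ℕ+ := η.map (· + 1)

/-- The identification `(η, 1) ∼ (τ η, 0)` on `βℕ × [0, 1]`. -/
def glue (p q : Ultrafilter ℕ+ × unitInterval) : Prop :=
  p.2 = 1 ∧ q = (tau p.1, 0)

/-- The compact space `Ω`, the quotient of `βℕ × [0, 1]` by `(η, 1) ∼ (τ η, 0)`. -/
def Omega : Type := Quot glue

instance : TopologicalSpace Omega := inferInstanceAs (TopologicalSpace (Quot glue))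

instance : MeasurableSpace Omega := borel Omega

instance : BorelSpace Omega := ⟨rfl⟩

/-- `ℕ* = βℕ ∖ ℕ`, the free ultrafilters. -/
abbrev NStar : Type := {η : Ultrafilter ℕ+ // η ∉ Set.range (pure : ℕ+ → Ultrafilter ℕ+)}

/-- The closed subspace `Ω*` of `Ω` of all points `(η, t)` with `η ∈ ℕ*`. -/
abbrev OmegaStar : Type :=
  {ω : Omega // ∃ (η : NStar) (t : unitInterval), Quot.mk glue (η.1, t) = ω}

/-- The point `(η, t)` of `Ω*`. -/
def point (η : NStar) (t : unitInterval) : OmegaStar := ⟨Quot.mk glue (η.1, t), η, t, rfl⟩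

/-- The map `n ↦ n + t` of `ℕ` into `[1, ∞)`. -/
def emb (t : unitInterval) (n : ℕ+) : HalfLine :=
  ⟨(n : ℝ) + t, le_add_of_le_of_nonneg (by exact_mod_cast n.2) t.2.1⟩

/-- The point `ω = (η, t)` of `Ω` as an ultrafilter on `[1, ∞)`, the one generated by the sets
`A + t`, `A ∈ η`. -/
def Omega.toUltrafilter : Omega → Ultrafilter HalfLine :=
  Quot.lift (fun p => p.1.map (emb p.2)) (by
    rintro ⟨η, t⟩ q ⟨ht, rfl⟩
    simp only at ht
    subst ht
    simp only [tau, Ultrafilter.map_map]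
    congr 1
    funext n
    apply Subtype.ext
    simp [emb])

/-- The map `x ↦ 2 ^ x` of `[1, ∞)` into itself. -/
def twoPow (x : HalfLine) : HalfLine :=
  ⟨(2 : ℝ) ^ (x : ℝ), Real.one_le_rpow (by norm_num) (zero_le_one.trans x.2)⟩

/-- `ψ_ω = ψ^(2^ω)`, that is, `ψ_ω(f) = ω-lim_x (1 / 2^x) ∫_1^(2^x) f(t) dt`. -/
def psi (ω : OmegaStar) (f : LInf) : ℝ := psiU (ω.1.toUltrafilter.map twoPow) f

/-- The restriction to `Ω*` of the continuous extension to `Ω` of `f`, given by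
`ω ↦ ω-lim_x f(x)`. -/
def bar (f : Cub) (ω : OmegaStar) : ℝ := ulim ω.1.toUltrafilter f.1

theorem not_pure_map {g : ℕ+ → ℕ+} (hg : ∀ n, (g ⁻¹' {n}).Finite) (η : NStar) :
    η.1.map g ∉ Set.range (pure : ℕ+ → Ultrafilter ℕ+) := by
  rintro ⟨n, hn⟩
  have h : ({n} : Set ℕ+) ∈ η.1.map g := by
    rw [← hn]
    exact Set.mem_singleton n
  obtain ⟨m, -, hm⟩ := Ultrafilter.eq_pure_of_finite_mem (hg n) (Ultrafilter.mem_map.mp h)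
  exact η.2 ⟨m, hm.symm⟩

/-- The homeomorphism `τ` of `ℕ*`, as a permutation. -/
def tauStar : Equiv.Perm NStar where
  toFun η := ⟨tau η.1, not_pure_map (g := fun n => n + 1) (fun n =>
    (Set.finite_singleton n).preimage (add_left_injective 1).injOn) η⟩
  invFun η := ⟨η.1.map fun n => n - 1, not_pure_map (fun n =>
    ((Set.finite_singleton (n + 1)).insert 1).subset (by
      intro m hm
      by_cases h1 : m = 1
      · exact Or.inl h1
      · refine Or.inr ?_
        have hm' : m - 1 = n := hm
        show m = n + 1
        rw [← hm', add_comm, PNat.add_sub_of_lt (lt_of_le_of_ne one_le (Ne.symm h1))])) η⟩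
  left_inv η := by
    apply Subtype.ext
    simp only [tau, Ultrafilter.map_map]
    have h : ((fun n : ℕ+ => n - 1) ∘ fun n => n + 1) = id := by
      funext n
      simp [PNat.add_sub]
    rw [h, Ultrafilter.map_id]
  right_inv η := by
    apply Subtype.ext
    simp only [tau, Ultrafilter.map_map]
    apply Ultrafilter.coe_injective
    have h1 : ({1} : Set ℕ+) ∉ η.1 := fun h => by
      obtain ⟨m, -, hm⟩ := Ultrafilter.eq_pure_of_finite_mem (Set.finite_singleton 1) h
      exact η.2 ⟨m, hm.symm⟩
    have h2 : ((fun n : ℕ+ => n + 1) ∘ fun n => n - 1) =ᶠ[(η.1 : Filter ℕ+)] id := by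
      filter_upwards [Ultrafilter.compl_mem_iff_notMem.mpr h1] with n hn
      have hn' : n ≠ 1 := hn
      show n - 1 + 1 = n
      rw [add_comm, PNat.add_sub_of_lt (lt_of_le_of_ne one_le (Ne.symm hn'))]
    rw [Ultrafilter.coe_map, Filter.map_congr h2, Filter.map_id]

/-- The flow `τ^s(η, t) = (τ^[t+s] η, t + s - [t+s])` on `Ω*`, as a function of `η`, `t`. -/
def tauFlow (s : ℝ) (η : NStar) (t : unitInterval) : OmegaStar :=
  point ((tauStar ^ ⌊(t : ℝ) + s⌋) η)
    ⟨Int.fract ((t : ℝ) + s), Int.fract_nonneg _, (Int.fract_lt_one _).le⟩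

/-! ### Probability measures on `Ω*` and the two flows -/

/-- The space `P(Ω*)` of regular Borel probability measures on the compact space `Ω*`, with the
weak* topology, that is, the coarsest topology for which `μ ↦ ∫ g dμ` is continuous for every
continuous `g`. -/
abbrev PStar : Type :=
  {μ : ProbabilityMeasure OmegaStar // (μ : Measure OmegaStar).Regular}

/-- The measure underlying an element of `P(Ω*)`. -/
abbrev PStar.measure (μ : PStar) : Measure OmegaStar := (μ.1 : Measure OmegaStar)

/-- `ρ = a μ + b ν` in `P(Ω*)`. -/
def IsMix (a b : ℝ) (μ ν ρ : PStar) : Prop :=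
  ρ.measure = ENNReal.ofReal a • μ.measure + ENNReal.ofReal b • ν.measure

/-- A continuous flow `{T_s^*}` on `P(Ω*)` which for `s ≥ 0` is given by the adjoints of the
operators `T_s`; a measure `μ ∈ P(Ω*)` is regarded as the functional
`f ↦ ∫ f̄(ω) dμ(ω)` on bounded uniformly continuous functions. -/
def IsTranslationFlow (T : Flow ℝ PStar) : Prop :=
  ∀ (s : ℝ≥0) (μ : PStar) (f : Cub),
    ∫ ω, bar f ω ∂(T (s : ℝ) μ).measure = ∫ ω, bar (translate s f) ω ∂μ.measure

/-- A continuous flow `{P_s^*}` on `ℳ` which for `s ≥ 0` is given by the adjoints of the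
operators `P_s`. -/
def IsDilationFlow (P : Flow ℝ M) : Prop :=
  ∀ (s : ℝ≥0) (ψ : M) (f : LInf), (P (s : ℝ) ψ).1 f = ψ.1 (dilate s f)

end CesaroFlow

end

noncomputable section

namespace CesaroFlow

/-! ### Limits along ultrafilters -/

/-! In the coordinate x = log₂ of the upper end, the Cesàro mean of f becomes `expMean f`, x ↦
2^(-x) ∫_1^(2^x) f, which is bounded and Lipschitz. Dilation by 2^s turns into translation by s, up
to an error that vanishes at infinity (`psi_dilate`). So everything about ℳ can be read off from
bounded uniformly continuous functions near infinity, that is, from C(Ω*): Ω* is compact Hausdorff,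
the functions `bar f` are dense in C(Ω*) by Stone–Weierstrass (`denseRange_barMap`), and every
ultrafilter at infinity acts on these functions as a point of Ω* (`exists_omega_ulim`).

Two facts about `psiMap f`, the function ω ↦ ψ_ω(f), carry the proof. The limsup of the means of f
is at most the supremum of `psiMap f` (`limsup_mean_le`), so ψ ∈ ℳ is dominated by that supremum. It
therefore descends to the range of `psiMap`, extends by Hahn–Banach to a positive normalized
functional on C(Ω*), and is integration against a measure by Riesz (`exists_integralPsi_eq`). And
`psiMap` has dense range (`denseRange_psiMap`), because the averaging can be undone approximately by
solving a first-order differential equation; this gives uniqueness of the measure and continuity of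
the inverse.

The flow on P(Ω*) is push-forward under τ^s, and the flow on ℳ is its conjugate by the
homeomorphism. The hull statements follow from Hahn–Banach separation: a weak* continuous functional
is evaluation at some f, and `limsup_mean_le` bounds it on ℳ by its values at the ψ_ω. -/

theorem ulim_eq {X : Type*} {𝒰 : Ultrafilter X} {g : X → ℝ} {a : ℝ}
    (h : Tendsto g 𝒰 (𝓝 a)) : ulim 𝒰 g = a :=
  h.limUnder_eq

/-- `limUnder` takes an arbitrary value when no limit exists; boundedness puts the image ultrafilter
in a compact interval and so rules this out. -/
theorem tendsto_ulim {X : Type*} (𝒰 : Ultrafilter X) {g : X → ℝ} {C : ℝ}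
    (h : ∀ x, ‖g x‖ ≤ C) : Tendsto g 𝒰 (𝓝 (ulim 𝒰 g)) := by
  have hm : ((𝒰.map g : Ultrafilter ℝ) : Filter ℝ) ≤ 𝓟 (Icc (-C) C) := by
    rw [le_principal_iff]
    exact Filter.mem_map.mpr (Filter.mem_of_superset univ_mem fun x _ => abs_le.mp (h x))
  obtain ⟨a, -, ha⟩ := isCompact_Icc.ultrafilter_le_nhds _ hm
  have ha' : Tendsto g 𝒰 (𝓝 a) := ha
  rwa [ulim_eq ha']

theorem ulim_map {X Y : Type*} (𝒰 : Ultrafilter X) (m : X → Y) (g : Y → ℝ) :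
    ulim (𝒰.map m) g = ulim 𝒰 (g ∘ m) := rfl

/-! ### Bounded uniformly continuous functions -/

/-- A bounded uniformly continuous function as an element of `Cub`. -/
def Cub.ofBound (F : HalfLine → ℝ) (hu : UniformContinuous F) (C : ℝ) (hC : ∀ x, ‖F x‖ ≤ C) :
    Cub :=
  ⟨BoundedContinuousFunction.ofNormedAddCommGroup F hu.continuous C hC, hu⟩

@[simp]
theorem Cub.ofBound_apply (F : HalfLine → ℝ) (hu : UniformContinuous F) (C : ℝ)
    (hC : ∀ x, ‖F x‖ ≤ C) (x : HalfLine) : (Cub.ofBound F hu C hC).1 x = F x := rfl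

theorem Cub.norm_apply_le (f : Cub) (x : HalfLine) : ‖f.1 x‖ ≤ ‖f‖ := f.1.norm_coe_le_norm x

theorem tendsto_ulim_cub (𝒰 : Ultrafilter HalfLine) (f : Cub) :
    Tendsto f.1 𝒰 (𝓝 (ulim 𝒰 f.1)) :=
  tendsto_ulim 𝒰 (Cub.norm_apply_le f)

theorem tendsto_bar (f : Cub) (ω : OmegaStar) :
    Tendsto f.1 ω.1.toUltrafilter (𝓝 (bar f ω)) :=
  tendsto_ulim_cub _ f

theorem toUltrafilter_point (η : NStar) (t : unitInterval) :
    (point η t).1.toUltrafilter = η.1.map (emb t) := rfl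

theorem tendsto_bar_point (f : Cub) (η : NStar) (t : unitInterval) :
    Tendsto (fun n => f.1 (emb t n)) η.1 (𝓝 (bar f (point η t))) :=
  tendsto_bar f (point η t)

theorem bar_point_eq {f : Cub} {η : NStar} {t : unitInterval} {a : ℝ}
    (h : Tendsto (fun n => f.1 (emb t n)) η.1 (𝓝 a)) : bar f (point η t) = a :=
  tendsto_nhds_unique (tendsto_bar_point f η t) h

theorem NStar.le_cofinite (η : NStar) : (η.1 : Filter ℕ+) ≤ cofinite := by
  rcases η.1.le_cofinite_or_eq_pure with h | ⟨a, ha⟩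
  · exact h
  · exact absurd ⟨a, Ultrafilter.coe_injective (by rw [ha])⟩ η.2

theorem NStar.tendsto_atTop (η : NStar) :
    Tendsto (fun n : ℕ+ => ((n : ℕ) : ℝ)) η.1 atTop := by
  refine tendsto_natCast_atTop_atTop.comp ?_
  rw [← Nat.cofinite_eq_atTop]
  exact PNat.coe_injective.tendsto_cofinite.mono_left η.le_cofinite

theorem OmegaStar.exists_point (ω : OmegaStar) : ∃ η t, point η t = ω := by
  obtain ⟨-, η, t, rfl⟩ := ω
  exact ⟨η, t, rfl⟩

theorem point_one (η : NStar) : point η 1 = point (tauStar η) 0 :=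
  Subtype.ext (Quot.sound ⟨rfl, rfl⟩)

/-- Normalizing to t < 1 removes the ambiguity of the gluing, so that distinct points can be
separated by comparing coordinates. -/
theorem OmegaStar.exists_point_lt_one (ω : OmegaStar) :
    ∃ (η : NStar) (t : unitInterval), (t : ℝ) < 1 ∧ point η t = ω := by
  obtain ⟨η, t, rfl⟩ := ω.exists_point
  rcases lt_or_eq_of_le t.2.2 with h | h
  · exact ⟨η, t, h, rfl⟩
  · obtain rfl : t = 1 := Subtype.ext h
    exact ⟨tauStar η, 0, by simp, (point_one η).symm⟩

theorem OmegaStar.le_atTop (ω : OmegaStar) : (ω.1.toUltrafilter : Filter HalfLine) ≤ atTop := by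
  obtain ⟨η, t, rfl⟩ := ω.exists_point
  rw [atTop_Ici_eq, ← tendsto_iff_comap, toUltrafilter_point, Ultrafilter.coe_map, tendsto_map'_iff]
  exact tendsto_atTop_mono (fun n => le_add_of_nonneg_right t.2.1) η.tendsto_atTop

/-- Points of Ω* see only the behaviour at infinity. This absorbs every cut-off at 1 and every
vanishing error below. -/
theorem bar_congr {f g : Cub} (h : Tendsto (fun x => f.1 x - g.1 x) atTop (𝓝 0))
    (ω : OmegaStar) : bar f ω = bar g ω := by
  have h1 := (tendsto_bar f ω).sub (tendsto_bar g ω)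
  exact sub_eq_zero.mp (tendsto_nhds_unique h1 (h.mono_left ω.le_atTop))

theorem abs_bar_le (f : Cub) (ω : OmegaStar) : ‖bar f ω‖ ≤ ‖f‖ :=
  le_of_tendsto (tendsto_bar f ω).norm (Eventually.of_forall (Cub.norm_apply_le f))

/-! ### Continuity of `bar f` -/

/-- Continuity is checked on all of Ω, where the quotient topology reduces it to βℕ × [0,1]. There a
basic open set of ultrafilters controls the first coordinate, and uniform continuity of f controls
the second uniformly in n. -/
theorem continuous_bar (f : Cub) : Continuous (bar f) := by
  suffices h : Continuous fun ω : Omega => ulim ω.toUltrafilter f.1 from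
    h.comp continuous_subtype_val
  refine continuous_coinduced_dom.mpr ?_
  rw [continuous_iff_continuousAt]
  rintro ⟨η, t⟩
  have key : ∀ (ξ : Ultrafilter ℕ+) (u : unitInterval),
      Tendsto (fun n => f.1 (emb u n)) ξ (𝓝 (ulim (ξ.map (emb u)) f.1)) := fun ξ u =>
    tendsto_ulim_cub (ξ.map (emb u)) f
  rw [Metric.continuousAt_iff']
  intro ε hε
  obtain ⟨δ, hδ, hf⟩ := Metric.uniformContinuous_iff.mp f.2 (ε / 3) (by positivity)
  have hA := Metric.tendsto_nhds.mp (key η t) (ε / 3) (by positivity)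
  have hopen := (ultrafilter_isOpen_basic
    {n | dist (f.1 (emb t n)) (ulim (η.map (emb t)) f.1) < ε / 3}).mem_nhds hA
  filter_upwards [prod_mem_nhds hopen (Metric.ball_mem_nhds t hδ)]
  rintro ⟨ξ, u⟩ ⟨hξ, hu⟩
  refine lt_of_le_of_lt (b := ε / 3 + ε / 3) ?_ (by linarith)
  refine le_of_tendsto ((key ξ u).dist tendsto_const_nhds) ?_
  filter_upwards [hξ] with n hn
  refine (dist_triangle _ (f.1 (emb t n)) _).trans (add_le_add (hf ?_).le (le_of_lt hn))
  have : dist (emb u n) (emb t n) = dist u t := by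
    simp [emb, Subtype.dist_eq, Real.dist_eq]
  rw [this]
  exact hu

/-- The map `f ↦ bar f` into the continuous functions on `Ω*`. -/
def barMap : Cub →ₗ[ℝ] C(OmegaStar, ℝ) where
  toFun f := ⟨bar f, continuous_bar f⟩
  map_add' f g := by
    ext ω
    exact ulim_eq ((tendsto_bar f ω).add (tendsto_bar g ω))
  map_smul' c f := by
    ext ω
    exact ulim_eq ((tendsto_bar f ω).const_smul c)

@[simp]
theorem barMap_apply (f : Cub) (ω : OmegaStar) : barMap f ω = bar f ω := rfl

/-! ### The space `Ω*` is compact and Hausdorff -/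

theorem isClosed_range_pure_compl :
    IsClosed {η : Ultrafilter ℕ+ | η ∉ Set.range (pure : ℕ+ → Ultrafilter ℕ+)} := by
  have : {η : Ultrafilter ℕ+ | η ∉ Set.range (pure : ℕ+ → Ultrafilter ℕ+)} =
      (⋃ n, {η : Ultrafilter ℕ+ | {n} ∈ η})ᶜ := by
    ext η
    simp only [mem_ofPred_eq, mem_compl_iff, mem_iUnion, mem_range, not_iff_not]
    refine exists_congr fun n => ⟨?_, fun h => ?_⟩
    · rintro rfl
      exact Set.mem_singleton n
    · obtain ⟨m, hm, rfl⟩ := Ultrafilter.eq_pure_of_finite_mem (Set.finite_singleton n) h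
      rw [Set.mem_singleton_iff.mp hm]
  rw [this]
  exact (isOpen_iUnion fun n => ultrafilter_isOpen_basic _).isClosed_compl

instance : CompactSpace NStar := isCompact_iff_compactSpace.mp isClosed_range_pure_compl.isCompact

theorem continuous_point : Continuous fun p : NStar × unitInterval => point p.1 p.2 := by
  refine Continuous.subtype_mk (continuous_coinduced_rng.comp ?_) _
  exact (continuous_subtype_val.comp continuous_fst).prodMk continuous_snd

instance : CompactSpace OmegaStar := by
  have : range (fun p : NStar × unitInterval => point p.1 p.2) = univ :=
    eq_univ_of_forall fun ω => by
      obtain ⟨η, t, rfl⟩ := ω.exists_point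
      exact ⟨(η, t), rfl⟩
  exact ⟨this ▸ isCompact_range continuous_point⟩

instance : Nonempty NStar := by
  have : Infinite ℕ+ := inferInstance
  refine ⟨⟨hyperfilter ℕ+, ?_⟩⟩
  rintro ⟨n, hn⟩
  have h : ({n} : Set ℕ+) ∈ hyperfilter ℕ+ := hn ▸ Set.mem_singleton n
  exact (Set.finite_singleton n).notMem_hyperfilter h

instance : Nonempty OmegaStar := ⟨point (Classical.arbitrary NStar) 0⟩

/-- The function `x ↦ min 1 (dist (x, A + t))`. -/
def distShift (A : Set ℕ+) (t : unitInterval) : Cub :=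
  Cub.ofBound (fun x => min 1 (Metric.infDist x (emb t '' A)))
    ((LipschitzWith.const_min (Metric.lipschitz_infDist_pt _) 1).uniformContinuous) 1 fun x => by
      rw [Real.norm_of_nonneg (le_min zero_le_one Metric.infDist_nonneg)]
      exact min_le_left _ _

theorem bar_distShift_eq_zero {A : Set ℕ+} {η : NStar} (hA : A ∈ η.1) (t : unitInterval) :
    bar (distShift A t) (point η t) = 0 := by
  refine bar_point_eq (tendsto_const_nhds.congr' ?_)
  filter_upwards [hA] with n hn
  simp [distShift, Metric.infDist_zero_of_mem (mem_image_of_mem (emb t) hn)]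

theorem bar_distShift_pos {A B : Set ℕ+} {η : NStar} {t u : unitInterval} {c : ℝ} (hc : 0 < c)
    (hA : A.Nonempty) (hB : B ∈ η.1) (h : ∀ m ∈ A, ∀ n ∈ B, c ≤ dist (emb u n) (emb t m)) :
    0 < bar (distShift A t) (point η u) := by
  refine lt_of_lt_of_le (lt_min zero_lt_one hc)
    (ge_of_tendsto (tendsto_bar_point _ _ _) ?_)
  filter_upwards [hB] with n hn
  refine min_le_min le_rfl ((Metric.le_infDist (hA.image _)).mpr ?_)
  rintro _ ⟨m, hm, rfl⟩
  exact h m hm n hn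

/-- The truncated distance to A + t vanishes in the limit at (η, t) when A ∈ η. For equal t, a set A
that distinguishes the ultrafilters works, since distinct integers are at distance at least 1; for
different t, the whole of ℕ + t works. -/
theorem exists_bar_ne {ω ω' : OmegaStar} (h : ω ≠ ω') : ∃ f : Cub, bar f ω ≠ bar f ω' := by
  obtain ⟨η, t, ht, rfl⟩ := ω.exists_point_lt_one
  obtain ⟨ξ, u, hu, rfl⟩ := ω'.exists_point_lt_one
  have ht0 := t.2.1
  have hu0 := u.2.1
  have hdist : ∀ m n : ℕ+, dist (emb u n) (emb t m) =
      |((n : ℤ) - (m : ℤ) : ℤ) + ((u : ℝ) - t)| := fun m n => by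
    simp only [emb, Subtype.dist_eq, Real.dist_eq]
    congr 1
    push_cast
    ring
  by_cases htu : t = u
  · subst htu
    have hne : η.1 ≠ ξ.1 := fun h' => h (by rw [Subtype.ext h'])
    obtain ⟨A, hA, hA'⟩ : ∃ A, A ∈ η.1 ∧ A ∉ ξ.1 := by
      by_contra! hcon
      exact hne (Ultrafilter.coe_le_coe.mp fun A hA => hcon A hA).symm
    refine ⟨distShift A t, ?_⟩
    rw [bar_distShift_eq_zero hA]
    refine (bar_distShift_pos zero_lt_one (Ultrafilter.nonempty_of_mem hA)
      (Ultrafilter.compl_mem_iff_notMem.mpr hA') fun m hm n hn => ?_).ne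
    rw [hdist, sub_self, add_zero]
    have : (n : ℤ) - (m : ℤ) ≠ 0 := by
      intro h0
      have : n = m := by
        have : (n : ℕ) = m := by omega
        exact PNat.coe_injective this
      exact hn (this ▸ hm)
    exact_mod_cast Int.one_le_abs this
  · have hne : (u : ℝ) - t ≠ 0 := fun h0 => htu (Subtype.ext (by linarith))
    refine ⟨distShift univ t, ?_⟩
    rw [bar_distShift_eq_zero univ_mem]
    -- As 0 < |u - t| < 1, every integer translate of u - t has absolute value at least this
    -- minimum.
    have hc : 0 < min |(u : ℝ) - t| (1 - |(u : ℝ) - t|) :=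
      lt_min (abs_pos.mpr hne) (sub_pos.mpr (abs_lt.mpr ⟨by linarith, by linarith⟩))
    refine (bar_distShift_pos hc univ_nonempty univ_mem fun m _ n _ => ?_).ne
    rw [hdist]
    by_cases h0 : (n : ℤ) - (m : ℤ) = 0
    · rw [h0]
      simp
    · refine (min_le_right _ _).trans ?_
      have h1 : (1 : ℝ) ≤ |(((n : ℤ) - (m : ℤ) : ℤ) : ℝ)| := by
        exact_mod_cast Int.one_le_abs h0
      have h2 := abs_sub_abs_le_abs_sub ((((n : ℤ) - (m : ℤ) : ℤ) : ℝ)) (-((u : ℝ) - t))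
      rw [abs_neg, sub_neg_eq_add] at h2
      linarith

/-- The evaluations `ω ↦ (bar f ω)_f`. -/
def barEval (ω : OmegaStar) (f : Cub) : ℝ := bar f ω

theorem continuous_barEval : Continuous barEval := continuous_pi fun f => continuous_bar f

theorem injective_barEval : Function.Injective barEval := fun ω ω' h => by
  by_contra hne
  obtain ⟨f, hf⟩ := exists_bar_ne hne
  exact hf (congrFun h f)

instance : T2Space OmegaStar := T2Space.of_injective_continuous injective_barEval continuous_barEval

/-- An injective continuous map from a compact space to a Hausdorff space is an embedding, so Ω* has
the topology induced by the functions `bar f`. -/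
theorem continuous_of_bar {Y : Type*} [TopologicalSpace Y] {φ : Y → OmegaStar}
    (h : ∀ f, Continuous fun y => bar f (φ y)) : Continuous φ :=
  (continuous_barEval.isClosedEmbedding injective_barEval).isInducing.continuous_iff.mpr
    (continuous_pi h)

theorem eq_of_bar {ω ω' : OmegaStar} (h : ∀ f, bar f ω = bar f ω') : ω = ω' :=
  injective_barEval (funext h)

/-- The product of two bounded uniformly continuous functions. -/
def Cub.mul (f g : Cub) : Cub :=
  Cub.ofBound (fun x => f.1 x * g.1 x) (by
    have hf := Metric.uniformContinuous_iff.mp f.2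
    have hg := Metric.uniformContinuous_iff.mp g.2
    refine Metric.uniformContinuous_iff.mpr fun ε hε => ?_
    have hC : 0 < ‖f‖ + ‖g‖ + 1 := by positivity
    obtain ⟨δ, hδ, h1⟩ := hf (ε / (‖f‖ + ‖g‖ + 1)) (by positivity)
    obtain ⟨δ', hδ', h2⟩ := hg (ε / (‖f‖ + ‖g‖ + 1)) (by positivity)
    refine ⟨min δ δ', lt_min hδ hδ', fun {a b} hab => ?_⟩
    have e1 := h1 (lt_of_lt_of_le hab (min_le_left _ _))
    have e2 := h2 (lt_of_lt_of_le hab (min_le_right _ _))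
    rw [Real.dist_eq] at e1 e2 ⊢
    have e3 : f.1 a * g.1 a - f.1 b * g.1 b =
        f.1 a * (g.1 a - g.1 b) + (f.1 a - f.1 b) * g.1 b := by ring
    have e4 : |f.1 a| ≤ ‖f‖ := Cub.norm_apply_le f a
    have e5 : |g.1 b| ≤ ‖g‖ := Cub.norm_apply_le g b
    calc |f.1 a * g.1 a - f.1 b * g.1 b|
        ≤ |f.1 a| * |g.1 a - g.1 b| + |f.1 a - f.1 b| * |g.1 b| := by
          rw [e3, ← abs_mul, ← abs_mul]
          exact abs_add_le _ _
      _ ≤ ‖f‖ * (ε / (‖f‖ + ‖g‖ + 1)) + (ε / (‖f‖ + ‖g‖ + 1)) * ‖g‖ := by gcongr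
      _ = (‖f‖ + ‖g‖) * (ε / (‖f‖ + ‖g‖ + 1)) := by ring
      _ < (‖f‖ + ‖g‖ + 1) * (ε / (‖f‖ + ‖g‖ + 1)) := by
          have : 0 < ε / (‖f‖ + ‖g‖ + 1) := by positivity
          nlinarith
      _ = ε := by field_simp) (‖f‖ * ‖g‖) fun x => by
    rw [norm_mul]
    exact mul_le_mul (Cub.norm_apply_le f x) (Cub.norm_apply_le g x) (norm_nonneg _) (norm_nonneg f)

theorem bar_mul (f g : Cub) (ω : OmegaStar) : bar (Cub.mul f g) ω = bar f ω * bar g ω :=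
  ulim_eq ((tendsto_bar f ω).mul (tendsto_bar g ω))

/-- The constant function. -/
def Cub.const (c : ℝ) : Cub :=
  Cub.ofBound (fun _ => c) uniformContinuous_const ‖c‖ fun _ => le_rfl

theorem bar_const (c : ℝ) (ω : OmegaStar) : bar (Cub.const c) ω = c :=
  ulim_eq (tendsto_const_nhds (x := c))

theorem denseRange_barMap : DenseRange barMap := by
  let A : Subalgebra ℝ C(OmegaStar, ℝ) :=
    { carrier := range barMap
      mul_mem' := by
        rintro _ _ ⟨f, rfl⟩ ⟨g, rfl⟩
        exact ⟨Cub.mul f g, by ext ω; simp [bar_mul]⟩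
      add_mem' := by
        rintro _ _ ⟨f, rfl⟩ ⟨g, rfl⟩
        exact ⟨f + g, map_add _ _ _⟩
      algebraMap_mem' := fun c => ⟨Cub.const c, by ext ω; simp [bar_const]⟩ }
  have hA : A.SeparatesPoints := fun ω ω' hne => by
    obtain ⟨f, hf⟩ := exists_bar_ne hne
    exact ⟨_, ⟨barMap f, ⟨f, rfl⟩, rfl⟩, hf⟩
  have h := ContinuousMap.subalgebra_topologicalClosure_eq_top_of_separatesPoints A hA
  intro g
  have : g ∈ A.topologicalClosure := h ▸ Algebra.mem_top
  exact this

/-! ### Ultrafilters on the half line tending to infinity -/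

/-- Split x into integer and fractional part: η is the image of 𝒰 under the floor, free because 𝒰
tends to infinity, and t is the 𝒰-limit of the fractional parts. Uniform continuity allows the
fractional part to be replaced by its limit, which may equal 1. -/
theorem exists_omega_ulim (𝒰 : Ultrafilter HalfLine) (h𝒰 : (𝒰 : Filter HalfLine) ≤ atTop) :
    ∃ ω : OmegaStar, ∀ f : Cub, ulim 𝒰 f.1 = bar f ω := by
  let fl : HalfLine → ℕ+ := fun x => ⟨⌊(x : ℝ)⌋₊, Nat.floor_pos.mpr x.2⟩
  have hfl : ∀ x, ((fl x : ℕ) : ℝ) = ⌊(x : ℝ)⌋₊ := fun x => rfl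
  have hx0 : ∀ x : HalfLine, (0 : ℝ) ≤ x := fun x => zero_le_one.trans x.2
  have hη : 𝒰.map fl ∉ Set.range (pure : ℕ+ → Ultrafilter ℕ+) := by
    rintro ⟨n, hn⟩
    have h1 : fl ⁻¹' {n} ∈ 𝒰 := by
      have : ({n} : Set ℕ+) ∈ 𝒰.map fl := hn ▸ Set.mem_singleton n
      exact this
    have h2 : {x : HalfLine | (n : ℝ) + 1 ≤ x} ∈ 𝒰 := by
      refine h𝒰 ?_
      rw [atTop_Ici_eq]
      exact ⟨_, mem_atTop _, Subset.rfl⟩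
    obtain ⟨x, hx1, hx2⟩ := Ultrafilter.nonempty_of_mem (Filter.inter_mem h1 h2)
    have h3 := Nat.lt_floor_add_one (x : ℝ)
    rw [← hfl, show fl x = n from hx1] at h3
    exact absurd hx2 (not_le.mpr h3)
  have hfrac : ∀ x : HalfLine, (x : ℝ) - fl x ∈ Icc (0 : ℝ) 1 := fun x => by
    have h1 := Nat.floor_le (hx0 x)
    have h2 := Nat.lt_floor_add_one (x : ℝ)
    rw [← hfl] at h1 h2
    exact ⟨by linarith, by linarith⟩
  have hbd : ∀ x : HalfLine, ‖(x : ℝ) - fl x‖ ≤ 1 := fun x => by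
    rw [Real.norm_of_nonneg (hfrac x).1]
    exact (hfrac x).2
  have ht := tendsto_ulim 𝒰 hbd
  set t₀ := ulim 𝒰 fun x : HalfLine => (x : ℝ) - fl x
  have ht₀ : t₀ ∈ Icc (0 : ℝ) 1 :=
    isClosed_Icc.mem_of_tendsto ht (Eventually.of_forall hfrac)
  refine ⟨point ⟨𝒰.map fl, hη⟩ ⟨t₀, ht₀⟩, fun f => ulim_eq ?_⟩
  have h1 : Tendsto (fun x => f.1 (emb ⟨t₀, ht₀⟩ (fl x))) 𝒰
      (𝓝 (bar f (point ⟨𝒰.map fl, hη⟩ ⟨t₀, ht₀⟩))) := tendsto_bar_point f _ _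
  rw [Metric.tendsto_nhds] at h1 ht ⊢
  intro ε hε
  obtain ⟨δ, hδ, hf⟩ := Metric.uniformContinuous_iff.mp f.2 (ε / 2) (by positivity)
  filter_upwards [h1 (ε / 2) (by positivity), ht δ hδ] with x hx1 hx2
  refine (dist_triangle _ (f.1 (emb ⟨t₀, ht₀⟩ (fl x))) _).trans_lt ?_
  have : dist (f.1 x) (f.1 (emb ⟨t₀, ht₀⟩ (fl x))) < ε / 2 := by
    refine hf ?_
    rw [Real.dist_eq] at hx2
    rw [Subtype.dist_eq, Real.dist_eq]
    convert hx2 using 2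
    simp only [emb]
    ring
  linarith

/-! ### The flow on `Ω*` -/

/-- The translation by a real number `s`, cut off at `1`. -/
def shiftHalf (s : ℝ) (x : HalfLine) : HalfLine := ⟨max 1 ((x : ℝ) + s), mem_Ici.mpr (le_max_left _ _)⟩

theorem dist_shiftHalf_le (s s' : ℝ) (x x' : HalfLine) :
    dist (shiftHalf s x) (shiftHalf s' x') ≤ dist x x' + dist s s' := by
  simp only [shiftHalf, Subtype.dist_eq, Real.dist_eq]
  rw [max_comm 1, max_comm 1]
  refine (abs_max_sub_max_le_abs ((x : ℝ) + s) (x' + s') 1).trans ?_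
  rw [show (x : ℝ) + s - (x' + s') = (x - x') + (s - s') by ring]
  exact abs_add_le _ _

theorem uniformContinuous_shiftHalf (s : ℝ) : UniformContinuous (shiftHalf s) :=
  (LipschitzWith.of_dist_le_mul (K := 1) fun x y => by
    simpa using dist_shiftHalf_le s s x y).uniformContinuous

/-- The function `x ↦ f (max 1 (x + s))`, for a real number `s`. -/
def shift (s : ℝ) (f : Cub) : Cub :=
  Cub.ofBound (fun x => f.1 (shiftHalf s x)) (UniformContinuous.comp f.2
    (uniformContinuous_shiftHalf s)) ‖f‖ fun _ => Cub.norm_apply_le f _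

theorem shift_coe (s : ℝ≥0) (f : Cub) : shift s f = translate s f := by
  refine Subtype.ext (BoundedContinuousFunction.ext fun x => ?_)
  change f.1 (shiftHalf s x) = f.1 (addHalf s x)
  congr 1
  have h : (1 : ℝ) ≤ (x : ℝ) + s := le_add_of_le_of_nonneg x.2 s.2
  exact Subtype.ext (max_eq_right h)

theorem exists_norm_shift_sub_le (f : Cub) {ε : ℝ} (hε : 0 < ε) :
    ∃ δ > 0, ∀ s s', dist s s' < δ → ‖shift s f - shift s' f‖ ≤ ε := by
  obtain ⟨δ, hδ, hf⟩ := Metric.uniformContinuous_iff.mp f.2 ε hε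
  refine ⟨δ, hδ, fun s s' h => ?_⟩
  refine (BoundedContinuousFunction.norm_le hε.le).mpr fun x => ?_
  have := dist_shiftHalf_le s s' x x
  rw [dist_self, zero_add] at this
  exact (hf (this.trans_lt h)).le

/-- Pushed into ℤ, powers of τ of either sign are honest translations; inside ℕ the negative ones
would need truncated subtraction. -/
theorem map_tauStar_zpow (η : NStar) (k : ℤ) :
    ((tauStar ^ k) η).1.map (fun n : ℕ+ => (n : ℤ)) = η.1.map fun n : ℕ+ => (n : ℤ) + k := by
  have hone : ∀ ξ : NStar, (tauStar ξ).1.map (fun n : ℕ+ => (n : ℤ)) =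
      (ξ.1.map fun n : ℕ+ => (n : ℤ)).map (· + 1) := fun ξ => by
    change (tau ξ.1).map _ = _
    rw [tau, Ultrafilter.map_map, Ultrafilter.map_map]
    rfl
  induction k with
  | zero => simp
  | succ k ih =>
    rw [add_comm, zpow_add, zpow_one, Equiv.Perm.mul_apply, hone, ih, Ultrafilter.map_map]
    congr 1
    funext n
    simp only [Function.comp]
    ring
  | pred k ih =>
    have hinj : Function.Injective fun 𝒱 : Ultrafilter ℤ => 𝒱.map (· + 1) := fun 𝒱 𝒲 h => by
      have h' := congrArg (fun 𝒱 : Ultrafilter ℤ => 𝒱.map (· - 1)) h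
      simpa [Ultrafilter.map_map, Function.comp_def] using h'
    apply hinj
    simp only
    rw [← hone, ← Equiv.Perm.mul_apply, ← zpow_one_add,
      show (1 : ℤ) + (-(k : ℤ) - 1) = -k by ring, ih, Ultrafilter.map_map]
    congr 1
    funext n
    simp only [Function.comp]
    ring

theorem bar_tauFlow (f : Cub) (s : ℝ) (η : NStar) (t : unitInterval) :
    bar f (tauFlow s η t) = bar (shift s f) (point η t) := by
  refine bar_point_eq ?_
  set k := ⌊(t : ℝ) + s⌋ with hk
  -- Extending the sampled function to ℤ by a cut-off lets `map_tauStar_zpow` apply; the cut-off is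
  -- inactive for η-almost all n.
  let F : ℤ → ℝ := fun m => f.1 (shiftHalf (Int.fract ((t : ℝ) + s)) ⟨max 1 (m : ℝ), mem_Ici.mpr (le_max_left _ _)⟩)
  have h2 : Tendsto F (η.1.map fun n : ℕ+ => (n : ℤ) + k)
      (𝓝 (bar (shift s f) (point η t))) := by
    rw [Ultrafilter.coe_map, tendsto_map'_iff]
    refine (tendsto_bar_point (shift s f) η t).congr' ?_
    have : ∀ᶠ n : ℕ+ in η.1, 1 - (k : ℝ) ≤ (n : ℕ) := η.tendsto_atTop (eventually_ge_atTop _)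
    filter_upwards [this] with n hn
    simp only [F, Function.comp, shift, Cub.ofBound_apply]
    congr 1
    apply Subtype.ext
    simp only [shiftHalf, emb]
    congr 1
    push_cast
    rw [max_eq_right (by linarith), Int.fract]
    ring
  rw [← map_tauStar_zpow, Ultrafilter.coe_map, tendsto_map'_iff] at h2
  refine h2.congr fun n => ?_
  simp only [F, Function.comp]
  congr 1
  apply Subtype.ext
  have hn : (1 : ℝ) ≤ (n : ℕ) := by exact_mod_cast n.2
  simp only [shiftHalf, emb, Int.cast_natCast]
  rw [max_eq_right hn, max_eq_right (by linarith [Int.fract_nonneg ((t : ℝ) + s)])]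

/-- Characterizing τ^s ω by its values under `bar` makes independence of the representative (η, t)
automatic, since these values separate points. -/
theorem exists_flowStar (s : ℝ) (ω : OmegaStar) :
    ∃ ω' : OmegaStar, ∀ f, bar f ω' = bar (shift s f) ω := by
  obtain ⟨η, t, rfl⟩ := ω.exists_point
  exact ⟨tauFlow s η t, fun f => bar_tauFlow f s η t⟩

/-- The flow `τ^s` on `Ω*`. -/
def flowStar (s : ℝ) (ω : OmegaStar) : OmegaStar := (exists_flowStar s ω).choose

theorem bar_flowStar (s : ℝ) (ω : OmegaStar) (f : Cub) :
    bar f (flowStar s ω) = bar (shift s f) ω := (exists_flowStar s ω).choose_spec f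

theorem flowStar_point (s : ℝ) (η : NStar) (t : unitInterval) :
    flowStar s (point η t) = tauFlow s η t :=
  eq_of_bar fun f => by rw [bar_flowStar, bar_tauFlow]

theorem continuous_flowStar (s : ℝ) : Continuous (flowStar s) :=
  continuous_of_bar fun f => by
    simp only [bar_flowStar]
    exact continuous_bar _

theorem bar_shift_zero (f : Cub) (ω : OmegaStar) : bar (shift 0 f) ω = bar f ω := by
  congr 1
  refine Subtype.ext (BoundedContinuousFunction.ext fun x => ?_)
  change f.1 (shiftHalf 0 x) = f.1 x
  congr 1
  apply Subtype.ext
  have : (1 : ℝ) ≤ x := x.2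
  simpa [shiftHalf]

/-- Because of the cut-off, `shift` is no group action on functions; the law holds for large x,
hence after applying `bar`. -/
theorem bar_shift_shift (s s' : ℝ) (f : Cub) (ω : OmegaStar) :
    bar (shift s (shift s' f)) ω = bar (shift (s' + s) f) ω := by
  refine bar_congr (tendsto_const_nhds.congr' ?_) ω
  have h : ∀ᶠ x : HalfLine in atTop, 1 - s ≤ (x : ℝ) := by
    rw [atTop_Ici_eq]
    exact tendsto_comap.eventually (eventually_ge_atTop _)
  filter_upwards [h] with x hx
  refine (sub_eq_zero.mpr ?_).symm
  simp only [shift, Cub.ofBound_apply]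
  congr 1
  apply Subtype.ext
  simp only [shiftHalf]
  rw [max_eq_right (a := 1) (b := (x : ℝ) + s) (by linarith)]
  congr 1
  ring

theorem flowStar_zero (ω : OmegaStar) : flowStar 0 ω = ω :=
  eq_of_bar fun f => by rw [bar_flowStar, bar_shift_zero]

theorem flowStar_add (s s' : ℝ) (ω : OmegaStar) :
    flowStar (s + s') ω = flowStar s (flowStar s' ω) :=
  eq_of_bar fun f => by rw [bar_flowStar, bar_flowStar, bar_flowStar, bar_shift_shift]

/-- The map `τ^s` as a homeomorphism of `Ω*`. -/
def flowStarHomeo (s : ℝ) : OmegaStar ≃ₜ OmegaStar where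
  toFun := flowStar s
  invFun := flowStar (-s)
  left_inv ω := by rw [← flowStar_add, neg_add_cancel, flowStar_zero]
  right_inv ω := by rw [← flowStar_add, add_neg_cancel, flowStar_zero]
  continuous_toFun := continuous_flowStar s
  continuous_invFun := continuous_flowStar (-s)

/-! ### The mean of a bounded measurable function -/

theorem ae_norm_le (f : LInf) : ∀ᵐ t ∂lebHalf, ‖f t‖ ≤ ‖f‖ := by
  have h := ae_le_eLpNormEssSup (f := (f : ℝ → ℝ)) (μ := lebHalf)
  filter_upwards [h] with t ht
  rw [Lp.norm_def, eLpNorm_exponent_top, ← toReal_enorm]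
  refine ENNReal.toReal_mono ?_ ht
  rw [← eLpNorm_exponent_top]
  exact (Lp.memLp f).2.ne

theorem ae_mem_of_ae_lebHalf {p : ℝ → Prop} (h : ∀ᵐ t ∂lebHalf, p t) {a b : ℝ} (ha : 1 ≤ a)
    (hb : 1 ≤ b) : ∀ᵐ t, t ∈ Set.uIoc a b → p t := by
  filter_upwards [(ae_restrict_iff' measurableSet_Ici).mp h] with t ht hm
  exact ht ((le_min ha hb).trans hm.1.le)

theorem intervalIntegrable_lInf (f : LInf) {a b : ℝ} (ha : 1 ≤ a) (hb : 1 ≤ b) :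
    IntervalIntegrable f volume a b := by
  rw [intervalIntegrable_iff]
  have hs : Set.uIoc a b ⊆ Ici 1 := fun t hm => (le_min ha hb).trans hm.1.le
  have : IsFiniteMeasure (volume.restrict (Set.uIoc a b)) := ⟨by
    rw [Measure.restrict_apply_univ, uIoc]; exact measure_Ioc_lt_top⟩
  exact ((Lp.memLp f).mono_measure (Measure.restrict_mono hs le_rfl)).integrable le_top

theorem norm_integral_lInf_le (f : LInf) {a b : ℝ} (ha : 1 ≤ a) (hb : 1 ≤ b) :
    ‖∫ t in a..b, f t‖ ≤ ‖f‖ * |b - a| :=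
  intervalIntegral.norm_integral_le_of_norm_le_const_ae
    (ae_mem_of_ae_lebHalf (ae_norm_le f) ha hb)

theorem norm_mean_le (f : LInf) {x : ℝ} (hx : 1 ≤ x) : ‖mean f x‖ ≤ ‖f‖ := by
  have h := norm_integral_lInf_le f le_rfl hx
  have hx0 : 0 < x := by linarith
  rw [mean, norm_mul, Real.norm_of_nonneg (by positivity), one_div, inv_mul_le_iff₀ hx0]
  rw [abs_of_nonneg (by linarith)] at h
  nlinarith [norm_nonneg f]

theorem mean_congr {f g : ℝ → ℝ} (h : f =ᵐ[lebHalf] g) {x : ℝ} (hx : 1 ≤ x) :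
    ∫ t in (1 : ℝ)..x, f t = ∫ t in (1 : ℝ)..x, g t :=
  intervalIntegral.integral_congr_ae (ae_mem_of_ae_lebHalf h le_rfl hx)

theorem abs_mean_sub_mean_le (f : LInf) {x y : ℝ} (hx : 1 ≤ x) (hxy : x ≤ y) :
    |mean f y - mean f x| ≤ 2 * ‖f‖ * (1 - x / y) := by
  have hx0 : 0 < x := by linarith
  have hy0 : 0 < y := by linarith
  have h1 := norm_integral_lInf_le f le_rfl hx
  have h2 := norm_integral_lInf_le f hx (hx.trans hxy)
  rw [abs_of_nonneg (by linarith), Real.norm_eq_abs] at h1 h2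
  have hadd := intervalIntegral.integral_add_adjacent_intervals
    (intervalIntegrable_lInf f le_rfl hx) (intervalIntegrable_lInf f hx (hx.trans hxy))
  have hkey : mean f y - mean f x =
      (1 / y) * (∫ t in x..y, f t) - (1 / x - 1 / y) * ∫ t in (1 : ℝ)..x, f t := by
    rw [mean, mean, ← hadd]
    ring
  have hc : 0 ≤ 1 / x - 1 / y := sub_nonneg.mpr (one_div_le_one_div_of_le hx0 hxy)
  calc |mean f y - mean f x|
      ≤ |(1 / y) * (∫ t in x..y, f t)| + |(1 / x - 1 / y) * ∫ t in (1 : ℝ)..x, f t| := by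
        rw [hkey]
        exact abs_sub _ _
    _ = (1 / y) * |∫ t in x..y, f t| + (1 / x - 1 / y) * |∫ t in (1 : ℝ)..x, f t| := by
        rw [abs_mul, abs_mul, abs_of_nonneg hc, abs_of_nonneg (by positivity)]
    _ ≤ (1 / y) * (‖f‖ * (y - x)) + (1 / x - 1 / y) * (‖f‖ * x) := by
        gcongr
        exact h1.trans (mul_le_mul_of_nonneg_left (by linarith) (norm_nonneg f))
    _ = 2 * ‖f‖ * (1 - x / y) := by
        field_simp
        ring

theorem one_le_twoPow (x : HalfLine) : (1 : ℝ) ≤ twoPow x := (twoPow x).2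

/-- The mean varies slowly on the multiplicative scale, so it is Lipschitz in the logarithmic
variable: 1 - 2^(x - y) ≤ (y - x) log 2 ≤ y - x for x ≤ y. -/
theorem dist_mean_twoPow_le (f : LInf) (x y : HalfLine) :
    dist (mean f (twoPow x)) (mean f (twoPow y)) ≤ 2 * ‖f‖ * dist x y := by
  wlog hxy : (x : ℝ) ≤ y generalizing x y
  · rw [dist_comm, dist_comm x]
    exact this y x (le_of_not_ge hxy)
  have hmono : (twoPow x : ℝ) ≤ twoPow y := Real.rpow_le_rpow_of_exponent_le (by norm_num) hxy
  rw [dist_comm, Real.dist_eq]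
  refine (abs_mean_sub_mean_le f (one_le_twoPow x) hmono).trans ?_
  refine mul_le_mul_of_nonneg_left ?_ (by positivity)
  have h1 : (twoPow x : ℝ) / twoPow y = Real.exp (Real.log 2 * (x - y)) := by
    rw [← Real.rpow_def_of_pos (by norm_num), Real.rpow_sub (by norm_num)]
    rfl
  have h2 := Real.add_one_le_exp (Real.log 2 * ((x : ℝ) - y))
  have h3 : Real.log 2 ≤ 1 := by linarith [Real.log_two_lt_d9]
  rw [h1, Subtype.dist_eq, Real.dist_eq, abs_of_nonpos (by linarith)]
  nlinarith

theorem mean_add (f g : LInf) {x : ℝ} (hx : 1 ≤ x) : mean (f + g) x = mean f x + mean g x := by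
  rw [mean, mean_congr (Lp.coeFn_add f g) hx]
  simp only [Pi.add_apply]
  rw [intervalIntegral.integral_add (intervalIntegrable_lInf f le_rfl hx)
    (intervalIntegrable_lInf g le_rfl hx), mul_add]
  rfl

theorem mean_smul (c : ℝ) (f : LInf) {x : ℝ} (hx : 1 ≤ x) : mean (c • f) x = c * mean f x := by
  rw [mean, mean_congr (Lp.coeFn_smul c f) hx]
  simp only [Pi.smul_apply, smul_eq_mul]
  rw [intervalIntegral.integral_const_mul, mean]
  ring

/-- The operator `f ↦ (x ↦ mean f (2 ^ x))` from `L^∞` into `Cub`. -/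
def expMean : LInf →ₗ[ℝ] Cub where
  toFun f := Cub.ofBound (fun x => mean f (twoPow x))
    (LipschitzWith.of_dist_le_mul (K := ⟨2 * ‖f‖, by positivity⟩)
      (dist_mean_twoPow_le f)).uniformContinuous ‖f‖ fun x => norm_mean_le f (one_le_twoPow x)
  map_add' f g := Subtype.ext (BoundedContinuousFunction.ext fun x =>
    mean_add f g (one_le_twoPow x))
  map_smul' c f := Subtype.ext (BoundedContinuousFunction.ext fun x =>
    mean_smul c f (one_le_twoPow x))

theorem expMean_apply (f : LInf) (x : HalfLine) : (expMean f).1 x = mean f (twoPow x) := rfl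

theorem psi_eq_bar (ω : OmegaStar) (f : LInf) : psi ω f = bar (expMean f) ω := by
  rw [psi, psiU, ulim_map, bar]
  exact congrArg (ulim _) (funext fun x => (expMean_apply f x).symm)

theorem norm_expMean_le (f : LInf) : ‖expMean f‖ ≤ ‖f‖ :=
  (BoundedContinuousFunction.norm_le (norm_nonneg f)).mpr fun x => norm_mean_le f (one_le_twoPow x)

/-- The map `f ↦ (ω ↦ psi ω f)`. -/
def psiMap : LInf →ₗ[ℝ] C(OmegaStar, ℝ) := barMap ∘ₗ expMean

@[simp]
theorem psiMap_apply (f : LInf) (ω : OmegaStar) : psiMap f ω = psi ω f :=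
  (psi_eq_bar ω f).symm

theorem norm_psi_le (f : LInf) (ω : OmegaStar) : ‖psi ω f‖ ≤ ‖f‖ := by
  rw [psi_eq_bar]
  exact (abs_bar_le _ ω).trans (norm_expMean_le f)

/-! ### Upper limits of means -/

theorem isBoundedUnder_mean (f : LInf) : IsBoundedUnder (· ≤ ·) atTop (mean f) :=
  isBoundedUnder_of_eventually_le (a := ‖f‖) <| by
    filter_upwards [eventually_ge_atTop 1] with x hx
    exact (le_abs_self _).trans (norm_mean_le f hx)

theorem isCoboundedUnder_mean (f : LInf) : IsCoboundedUnder (· ≤ ·) atTop (mean f) := by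
  refine IsBoundedUnder.isCoboundedUnder_le (isBoundedUnder_of_eventually_ge (a := -‖f‖) ?_)
  filter_upwards [eventually_ge_atTop 1] with x hx
  exact neg_le_of_abs_le (norm_mean_le f hx)

theorem tendsto_psiU (𝒰 : Ultrafilter HalfLine) (f : LInf) :
    Tendsto (fun x : HalfLine => mean f x) 𝒰 (𝓝 (psiU 𝒰 f)) :=
  tendsto_ulim 𝒰 fun x => norm_mean_le f x.2

theorem psiU_le_limsup {𝒰 : Ultrafilter HalfLine} (h : (𝒰 : Filter HalfLine) ≤ atTop) (f : LInf) :
    psiU 𝒰 f ≤ limsup (mean f) atTop := by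
  refine le_of_forall_gt_imp_ge_of_dense fun c hc => ?_
  have h1 := eventually_lt_of_limsup_lt hc (isBoundedUnder_mean f)
  have h2 : Tendsto (Subtype.val : HalfLine → ℝ) 𝒰 atTop := by
    rw [atTop_Ici_eq] at h
    exact tendsto_iff_comap.mpr h
  exact le_of_tendsto (tendsto_psiU 𝒰 f) ((h2.eventually h1).mono fun x hx => hx.le)

/-- The binary logarithm, cut off at `1`. -/
def logHalf (x : ℝ) : HalfLine := ⟨max 1 (Real.logb 2 x), mem_Ici.mpr (le_max_left _ _)⟩

theorem twoPow_logHalf {x : ℝ} (hx : 2 ≤ x) : (twoPow (logHalf x) : ℝ) = x := by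
  have h : 1 ≤ Real.logb 2 x := by
    rw [Real.le_logb_iff_rpow_le (by norm_num) (by linarith)]
    simpa
  simp only [twoPow, logHalf]
  rw [max_eq_right h, Real.rpow_logb (by norm_num) (by norm_num) (by linarith)]

theorem tendsto_logHalf : Tendsto logHalf atTop atTop := by
  rw [tendsto_Ici_atTop]
  exact tendsto_atTop_mono (fun x => le_max_right _ _) (Real.tendsto_logb_atTop (by norm_num))

/-- If the limsup exceeded c' > c, the set of y where the mean at 2^y exceeds c' would be unbounded.
An ultrafilter at infinity on that set acts as a point ω with ψ_ω(f) ≥ c'. -/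
theorem limsup_mean_le {f : LInf} {c : ℝ} (h : ∀ ω, psi ω f ≤ c) :
    limsup (mean f) atTop ≤ c := by
  by_contra! hc
  obtain ⟨c', hcc', hc'⟩ := exists_between hc
  have h1 := frequently_lt_of_lt_limsup (isCoboundedUnder_mean f) hc'
  have h2 : ∃ᶠ y in (atTop : Filter HalfLine), c' < mean f (twoPow y) := by
    refine tendsto_logHalf.frequently ((h1.and_eventually (eventually_ge_atTop 2)).mono ?_)
    rintro x ⟨hx, hx2⟩
    rwa [twoPow_logHalf hx2]
  have : (atTop ⊓ 𝓟 {y : HalfLine | c' < mean f (twoPow y)}).NeBot :=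
    frequently_mem_iff_neBot.mp h2
  have h𝒰 := Ultrafilter.of_le (atTop ⊓ 𝓟 {y : HalfLine | c' < mean f (twoPow y)})
  set 𝒰 := Ultrafilter.of (atTop ⊓ 𝓟 {y : HalfLine | c' < mean f (twoPow y)})
  obtain ⟨ω, hω⟩ := exists_omega_ulim 𝒰 (h𝒰.trans inf_le_left)
  have h3 := tendsto_ulim_cub 𝒰 (expMean f)
  rw [hω, ← psi_eq_bar] at h3
  have h4 : c' ≤ psi ω f := by
    refine ge_of_tendsto h3 ?_
    have : {y : HalfLine | c' < mean f (twoPow y)} ∈ (𝒰 : Filter HalfLine) :=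
      le_principal_iff.mp (h𝒰.trans inf_le_right)
    filter_upwards [this] with y hy
    exact le_of_lt hy
  linarith [h ω]

theorem tendsto_inv_twoPow : Tendsto (fun x : HalfLine => (twoPow x : ℝ)⁻¹) atTop (𝓝 0) := by
  have h1 : Tendsto (fun x : ℝ => (2 : ℝ) ^ x) atTop atTop :=
    tendsto_rpow_atTop_of_base_gt_one 2 (by norm_num)
  have h2 : Tendsto (Subtype.val : HalfLine → ℝ) atTop atTop := by
    rw [atTop_Ici_eq]
    exact tendsto_comap
  exact tendsto_inv_atTop_zero.comp (h1.comp h2)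

/-- With c = 2^s and X = 2^x, substitution shows that the two means differ only by (cX)⁻¹ ∫_1^c f,
which tends to 0. -/
theorem psi_dilate (s : ℝ≥0) (f : LInf) (ω : OmegaStar) :
    psi ω (dilate s f) = bar (translate s (expMean f)) ω := by
  rw [psi_eq_bar]
  have hlim := tendsto_inv_twoPow.const_mul
    (-(((2 : ℝ) ^ (s : ℝ))⁻¹ * ∫ t in (1 : ℝ)..(2 : ℝ) ^ (s : ℝ), f t))
  rw [mul_zero] at hlim
  refine bar_congr (hlim.congr fun x => ?_) ω
  set c := (2 : ℝ) ^ (s : ℝ) with hc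
  have hc1 : 1 ≤ c := Real.one_le_rpow (by norm_num) s.2
  have hX := one_le_twoPow x
  set X : ℝ := (twoPow x).1 with hXdef
  have hcX : 1 ≤ c * X := by nlinarith
  have hadd := intervalIntegral.integral_add_adjacent_intervals
    (intervalIntegrable_lInf f le_rfl hc1) (intervalIntegrable_lInf f hc1 hcX)
  have h1 : (expMean (dilate s f)).1 x = (1 / X) * (c⁻¹ * ∫ t in c..c * X, f t) := by
    rw [expMean_apply, mean, ← hXdef]
    congr 1
    have hcoe : (dilate s f : ℝ → ℝ) =ᵐ[lebHalf] fun t => f (c * t) :=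
      MemLp.coeFn_toLp (memLp_dilate s f)
    rw [mean_congr hcoe hX,
      intervalIntegral.integral_comp_mul_left (fun t => f t) (by positivity), mul_one, smul_eq_mul]
  have h2 : (translate s (expMean f)).1 x = (1 / (c * X)) * ∫ t in (1 : ℝ)..c * X, f t := by
    change mean f (twoPow (addHalf s x)) = _
    have : (twoPow (addHalf s x) : ℝ) = c * X := by
      rw [hc, hXdef]
      simp only [twoPow, addHalf]
      rw [add_comm, Real.rpow_add (by norm_num)]
    rw [this, mean]
  rw [h1, h2, ← hadd]
  field_simp
  ring

/-! ### Density of the functions `ω ↦ psi ω f` -/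

/-- If H is C¹ with H and H' bounded, then the derivative of t H(log₂ t) is (H + H'/log 2)(log₂ t).
The mean of this bounded function at 2^x is therefore H(x) - H(0) 2^(-x). It remains to approximate
g uniformly by such an H. -/
theorem exists_expMean_approx (g : Cub) {ε : ℝ} (hε : 0 < ε) :
    ∃ f : LInf, ∀ᶠ x in atTop, |(expMean f).1 x - g.1 x| ≤ ε := by
  have hG0 : ∃ G : ℝ → ℝ, UniformContinuous G ∧ (∀ x, |G x| ≤ ‖g‖) ∧
      ∀ x : HalfLine, G x = g.1 x := by
    refine ⟨fun x => g.1 ⟨max 1 x, mem_Ici.mpr (le_max_left _ _)⟩, ?_,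
      fun x => Cub.norm_apply_le g _, fun x => ?_⟩
    · refine UniformContinuous.comp g.2 (UniformContinuous.subtype_mk ?_ _)
      exact (LipschitzWith.const_max LipschitzWith.id 1).uniformContinuous
    · have hx : max 1 (x : ℝ) = x := max_eq_right x.2
      exact congrArg g.1 (Subtype.ext hx)
  obtain ⟨G, hGu, hGb, hGg⟩ := hG0
  have hGc := hGu.continuous
  obtain ⟨δ, hδ, hG⟩ := Metric.uniformContinuous_iff.mp hGu (ε / 2) (by positivity)
  obtain ⟨h, hh, hhδ⟩ := exists_between hδ
  -- A moving average over a window h < δ: within ε/2 of G by uniform continuity, and with the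
  -- bounded derivative (G(x + h) - G(x))/h.
  set H : ℝ → ℝ := fun x => h⁻¹ * ∫ t in x..x + h, G t with hH
  have hint : ∀ a b, IntervalIntegrable G volume a b := fun a b => hGc.intervalIntegrable a b
  have hHderiv : ∀ x, HasDerivAt H (h⁻¹ * (G (x + h) - G x)) x := fun x => by
    have h0 : H = fun x => h⁻¹ * ((∫ t in (0 : ℝ)..x + h, G t) - ∫ t in (0 : ℝ)..x, G t) := by
      funext y
      rw [hH, intervalIntegral.integral_interval_sub_left (hint _ _) (hint _ _)]
    rw [h0]
    refine HasDerivAt.const_mul _ (HasDerivAt.sub ?_ ?_)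
    · have := (intervalIntegral.integral_hasDerivAt_right (hint 0 (x + h))
        (hGc.stronglyMeasurableAtFilter _ _) hGc.continuousAt)
      exact this.comp_add_const x h
    · exact intervalIntegral.integral_hasDerivAt_right (hint 0 x)
        (hGc.stronglyMeasurableAtFilter _ _) hGc.continuousAt
  have hHc : Continuous H := continuous_iff_continuousAt.mpr fun x => (hHderiv x).continuousAt
  have hHG : ∀ x, |H x - G x| ≤ ε / 2 := fun x => by
    have e1 : H x - G x = h⁻¹ * ∫ t in x..x + h, (G t - G x) := by
      rw [intervalIntegral.integral_sub (hint _ _) intervalIntegrable_const,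
        intervalIntegral.integral_const, hH, smul_eq_mul]
      field_simp
      ring
    have e2 : ‖∫ t in x..x + h, (G t - G x)‖ ≤ ε / 2 * |x + h - x| := by
      refine intervalIntegral.norm_integral_le_of_norm_le_const fun t ht => ?_
      rw [uIoc_of_le (by linarith)] at ht
      refine le_of_lt (hG ?_)
      rw [Real.dist_eq, abs_of_pos (by linarith [ht.1])]
      linarith [ht.2]
    rw [Real.norm_eq_abs, add_sub_cancel_left, abs_of_pos hh] at e2
    rw [e1, abs_mul, abs_of_pos (by positivity), inv_mul_le_iff₀ hh]
    linarith
  have hlog : 0 < Real.log 2 := Real.log_pos (by norm_num)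
  set φ : ℝ → ℝ := fun x => H x + h⁻¹ * (G (x + h) - G x) / Real.log 2 with hφ
  have hφc : Continuous φ := by fun_prop
  have hφb : ∀ x, ‖φ x‖ ≤ (‖g‖ + ε / 2) + h⁻¹ * (‖g‖ + ‖g‖) / Real.log 2 := fun x => by
    refine (norm_add_le _ _).trans (add_le_add ?_ ?_)
    · have := abs_sub_abs_le_abs_sub (H x) (G x)
      rw [Real.norm_eq_abs]
      linarith [hHG x, hGb x]
    · rw [norm_div, norm_mul, Real.norm_of_nonneg hlog.le, Real.norm_of_nonneg (by positivity)]
      gcongr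
      exact (norm_sub_le _ _).trans (add_le_add (hGb _) (hGb _))
  have hmeas : Measurable fun t : ℝ => φ (Real.log t / Real.log 2) :=
    hφc.measurable.comp (Real.measurable_log.div_const _)
  have hmem : MemLp (fun t : ℝ => φ (Real.log t / Real.log 2)) ∞ lebHalf :=
    memLp_top_of_bound hmeas.aestronglyMeasurable _ (Eventually.of_forall fun t => hφb _)
  refine ⟨hmem.toLp _, ?_⟩
  have hformula : ∀ x : HalfLine, (expMean (hmem.toLp _)).1 x = H x - H 0 * (twoPow x : ℝ)⁻¹ := by
    intro x
    have hX := one_le_twoPow x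
    have hXlog : Real.log (twoPow x) / Real.log 2 = x := by
      simp only [twoPow]
      rw [Real.log_rpow (by norm_num)]
      field_simp
    rw [expMean_apply, mean, mean_congr hmem.coeFn_toLp hX]
    set X : ℝ := (twoPow x).1
    have hpos : ∀ t ∈ uIcc 1 X, 0 < t := fun t ht => by
      rw [uIcc_of_le hX] at ht
      linarith [ht.1]
    have hftc := intervalIntegral.integral_eq_sub_of_hasDerivAt (a := 1) (b := X)
      (f := fun t => t * H (Real.log t / Real.log 2))
      (f' := fun t => φ (Real.log t / Real.log 2)) (fun t ht => by
        have ht0 := hpos t ht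
        have h1 : HasDerivAt (fun t => Real.log t / Real.log 2) (t⁻¹ / Real.log 2) t :=
          (Real.hasDerivAt_log ht0.ne').div_const _
        have h2 := (hasDerivAt_id t).mul ((hHderiv (Real.log t / Real.log 2)).comp t h1)
        refine h2.congr_deriv ?_
        simp only [hφ, id, Function.comp]
        field_simp) (by
        refine ContinuousOn.intervalIntegrable fun t ht => ContinuousAt.continuousWithinAt ?_
        exact hφc.continuousAt.comp
          ((Real.continuousAt_log (hpos t ht).ne').div_const _))
    rw [hftc, hXlog, Real.log_one, zero_div]
    have : X ≠ 0 := by linarith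
    field_simp
  have hev := (tendsto_inv_twoPow.const_mul (H 0)).abs
  rw [mul_zero, abs_zero] at hev
  filter_upwards [hev.eventually (gt_mem_nhds (half_pos hε))] with x hx
  rw [hformula, ← hGg]
  calc |H x - H 0 * (twoPow x : ℝ)⁻¹ - G x|
      = |(H x - G x) - H 0 * (twoPow x : ℝ)⁻¹| := by congr 1; ring
    _ ≤ |H x - G x| + |H 0 * (twoPow x : ℝ)⁻¹| := abs_sub _ _
    _ ≤ ε := by linarith [hHG x]

theorem denseRange_psiMap : DenseRange psiMap := by
  refine Metric.denseRange_iff.mpr fun g r hr => ?_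
  obtain ⟨g', hg'⟩ := Metric.denseRange_iff.mp denseRange_barMap g (r / 2) (by positivity)
  obtain ⟨f, hf⟩ := exists_expMean_approx g' (ε := r / 4) (by positivity)
  refine ⟨f, (dist_triangle _ (barMap g') _).trans_lt ?_⟩
  have : dist (barMap g') (psiMap f) ≤ r / 4 := by
    refine (ContinuousMap.dist_le (by positivity)).mpr fun ω => ?_
    rw [dist_comm, Real.dist_eq, psiMap_apply, psi_eq_bar]
    exact le_of_tendsto ((tendsto_bar (expMean f) ω).sub (tendsto_bar g' ω)).abs (ω.le_atTop hf)
  linarith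

/-! ### Integrals over `Ω*` -/

theorem integrable_continuousMap (μ : PStar) (g : C(OmegaStar, ℝ)) :
    Integrable (fun ω => g ω) μ.measure :=
  (BoundedContinuousFunction.mkOfCompact g).integrable μ.measure

theorem abs_integral_sub_integral_le (μ : PStar) (g g' : C(OmegaStar, ℝ)) {C : ℝ}
    (h : ∀ ω, dist (g ω) (g' ω) ≤ C) : |∫ ω, g ω ∂μ.measure - ∫ ω, g' ω ∂μ.measure| ≤ C := by
  rw [← integral_sub (integrable_continuousMap μ g) (integrable_continuousMap μ g')]
  have := norm_integral_le_of_norm_le_const (μ := μ.measure) (f := fun ω => g ω - g' ω)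
    (Eventually.of_forall h)
  simpa using this

theorem continuous_integral_continuousMap (μ : PStar) :
    Continuous fun g : C(OmegaStar, ℝ) => ∫ ω, g ω ∂μ.measure :=
  (LipschitzWith.of_dist_le_mul (K := 1) fun g g' => by
    rw [NNReal.coe_one, one_mul]
    exact abs_integral_sub_integral_le μ g g' fun ω => ContinuousMap.dist_apply_le_dist ω).continuous

/-- Integration is 1-Lipschitz in the integrand, so equality spreads from the dense family to C(Ω*);
regularity then identifies the measures. -/
theorem PStar.ext_of_denseRange {ι : Type*} {F : ι → C(OmegaStar, ℝ)} (hF : DenseRange F)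
    {μ ν : PStar} (h : ∀ i, ∫ ω, F i ω ∂μ.measure = ∫ ω, F i ω ∂ν.measure) : μ = ν := by
  have key := hF.equalizer (continuous_integral_continuousMap μ)
    (continuous_integral_continuousMap ν) (funext h)
  have : μ.measure.Regular := μ.2
  have : ν.measure.Regular := ν.2
  suffices h : μ.measure = ν.measure from Subtype.ext (Subtype.ext h)
  exact Measure.ext_of_integral_eq_on_compactlySupported fun g => congrFun key g.toContinuousMap

/-- The Lipschitz bound is uniform over probability measures, so continuity passes to uniform limits
of integrands. -/
theorem PStar.continuous_of_denseRange {ι Y : Type*} [TopologicalSpace Y]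
    {F : ι → C(OmegaStar, ℝ)} (hF : DenseRange F) {φ : Y → PStar}
    (h : ∀ i, Continuous fun y => ∫ ω, F i ω ∂(φ y).measure) : Continuous φ := by
  have key : ∀ g : C(OmegaStar, ℝ), Continuous fun y => ∫ ω, g ω ∂(φ y).measure := fun g => by
    refine continuous_of_uniform_approx_of_continuous fun u hu => ?_
    obtain ⟨ε, hε, hu⟩ := Metric.mem_uniformity_dist.mp hu
    obtain ⟨i, hi⟩ := Metric.denseRange_iff.mp hF g ε hε
    refine ⟨_, h i, fun y => hu ?_⟩
    exact (abs_integral_sub_integral_le (φ y) g (F i)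
      fun ω => ContinuousMap.dist_apply_le_dist ω).trans_lt hi
  refine continuous_induced_rng.mpr (continuous_iff_continuousAt.mpr fun y => ?_)
  exact ProbabilityMeasure.tendsto_iff_forall_integral_tendsto.mpr fun g =>
    (key g.toContinuousMap).continuousAt

theorem PStar.continuous_integral (g : C(OmegaStar, ℝ)) :
    Continuous fun μ : PStar => ∫ ω, g ω ∂μ.measure :=
  continuous_iff_continuousAt.mpr fun _ =>
    ProbabilityMeasure.tendsto_iff_forall_integral_tendsto.mp
      continuous_subtype_val.continuousAt (BoundedContinuousFunction.mkOfCompact g)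

/-- A positive normalized functional on `C(Ω*)` is given by a measure. -/
theorem exists_pstar_of_functional (L : C(OmegaStar, ℝ) →ₗ[ℝ] ℝ) (hpos : ∀ g, 0 ≤ g → 0 ≤ L g)
    (hone : L 1 = 1) : ∃ μ : PStar, ∀ g : C(OmegaStar, ℝ), ∫ ω, g ω ∂μ.measure = L g := by
  let Λ : CompactlySupportedContinuousMap OmegaStar ℝ →ₚ[ℝ] ℝ :=
    { toFun g := L g.toContinuousMap
      map_add' g g' := L.map_add _ _
      map_smul' c g := L.map_smul _ _
      monotone' g g' hgg' := by
        have := hpos (g'.toContinuousMap - g.toContinuousMap) fun ω => sub_nonneg.mpr (hgg' ω)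
        rw [map_sub] at this
        exact sub_nonneg.mp this }
  have key : ∀ g : C(OmegaStar, ℝ), ∫ ω, g ω ∂(RealRMK.rieszMeasure Λ) = L g := fun g =>
    RealRMK.integral_rieszMeasure Λ ⟨g, HasCompactSupport.of_compactSpace _⟩
  have hprob : IsProbabilityMeasure (RealRMK.rieszMeasure Λ) := by
    have h1 := key 1
    rw [hone] at h1
    simp only [ContinuousMap.one_apply, integral_const, smul_eq_mul, mul_one] at h1
    exact ⟨by rwa [measureReal_def, ENNReal.toReal_eq_one_iff] at h1⟩
  exact ⟨⟨⟨RealRMK.rieszMeasure Λ, hprob⟩, RealRMK.regular_rieszMeasure Λ⟩, key⟩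

/-- Inner regularity is inherited by sums and multiples and is immediate for point masses; this
brings convex combinations and Dirac measures into P(Ω*). -/
theorem regular_of_innerRegular {X : Type*} [TopologicalSpace X] [MeasurableSpace X]
    [BorelSpace X] [T2Space X] (μ : Measure X) [IsFiniteMeasure μ] [μ.InnerRegular] :
    μ.Regular := inferInstance

theorem exists_isMix {a b : ℝ} (μ ν : PStar) (ha : 0 ≤ a) (hb : 0 ≤ b) (hab : a + b = 1) :
    ∃ ρ : PStar, IsMix a b μ ν ρ := by
  have := μ.2
  have := ν.2
  have hprob : IsProbabilityMeasure
      (ENNReal.ofReal a • μ.measure + ENNReal.ofReal b • ν.measure) := ⟨by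
    simp only [Measure.coe_add, Measure.coe_smul, Pi.add_apply, Pi.smul_apply, measure_univ,
      smul_eq_mul, mul_one]
    rw [← ENNReal.ofReal_add ha hb, hab, ENNReal.ofReal_one]⟩
  exact ⟨⟨⟨_, hprob⟩, regular_of_innerRegular
    (ENNReal.ofReal a • μ.measure + ENNReal.ofReal b • ν.measure)⟩, rfl⟩

theorem IsMix.integral_eq {a b : ℝ} {μ ν ρ : PStar} (h : IsMix a b μ ν ρ) (ha : 0 ≤ a)
    (hb : 0 ≤ b) (g : C(OmegaStar, ℝ)) :
    ∫ ω, g ω ∂ρ.measure = a * ∫ ω, g ω ∂μ.measure + b * ∫ ω, g ω ∂ν.measure := by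
  rw [show ρ.measure = _ from h, integral_add_measure
    ((integrable_continuousMap μ g).smul_measure ENNReal.ofReal_ne_top)
    ((integrable_continuousMap ν g).smul_measure ENNReal.ofReal_ne_top),
    integral_smul_measure, integral_smul_measure, ENNReal.toReal_ofReal ha,
    ENNReal.toReal_ofReal hb, smul_eq_mul, smul_eq_mul]

theorem innerRegular_dirac (ω : OmegaStar) : (Measure.dirac ω).InnerRegular := ⟨by
  intro A hA r hr
  have hω : ω ∈ A := by
    by_contra hω
    rw [Measure.dirac_apply' _ hA, indicator_of_notMem hω] at hr
    exact not_lt_bot hr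
  refine ⟨{ω}, singleton_subset_iff.mpr hω, isCompact_singleton, hr.trans_le ?_⟩
  rw [Measure.dirac_apply_of_mem (mem_singleton ω)]
  exact prob_le_one⟩

/-- The point mass at `ω`. -/
def diracStar (ω : OmegaStar) : PStar :=
  ⟨⟨Measure.dirac ω, Measure.dirac.isProbabilityMeasure⟩, by
    have := innerRegular_dirac ω
    exact regular_of_innerRegular (Measure.dirac ω)⟩

theorem diracStar_measure (ω : OmegaStar) : (diracStar ω).measure = Measure.dirac ω := rfl

theorem integral_diracStar (ω : OmegaStar) (g : C(OmegaStar, ℝ)) :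
    ∫ ω', g ω' ∂(diracStar ω).measure = g ω := by
  rw [diracStar_measure]
  exact integral_dirac _ ω

/-! ### The translation flow -/

/-- Push-forward of a measure under `τ^s`. -/
def pushStar (s : ℝ) (μ : PStar) : PStar :=
  ⟨μ.1.map (continuous_flowStar s).aemeasurable, by
    have := μ.2
    exact Measure.Regular.map (μ := μ.measure) (flowStarHomeo s)⟩

theorem pushStar_measure (s : ℝ) (μ : PStar) :
    (pushStar s μ).measure = μ.measure.map (flowStar s) := rfl

theorem integral_bar_pushStar (s : ℝ) (μ : PStar) (f : Cub) :
    ∫ ω, bar f ω ∂(pushStar s μ).measure = ∫ ω, bar (shift s f) ω ∂μ.measure := by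
  rw [pushStar_measure, integral_map (continuous_flowStar s).aemeasurable
    (continuous_bar f).aestronglyMeasurable]
  simp only [bar_flowStar]

/-- Moving s costs at most ‖shift s' f - shift s f‖, uniformly in the measure; with s fixed, weak*
continuity handles the measure. -/
theorem continuous_integral_bar_shift (f : Cub) :
    Continuous fun p : ℝ × PStar => ∫ ω, bar (shift p.1 f) ω ∂p.2.measure := by
  refine continuous_iff_continuousAt.mpr fun ⟨s, μ⟩ => ?_
  rw [Metric.continuousAt_iff']
  intro ε hε
  obtain ⟨δ, hδ, hshift⟩ := exists_norm_shift_sub_le f (half_pos hε)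
  have hμ := Metric.continuousAt_iff'.mp
    ((PStar.continuous_integral (barMap (shift s f))).continuousAt (x := μ)) (ε / 2) (half_pos hε)
  rw [nhds_prod_eq]
  filter_upwards [prod_mem_prod (Metric.ball_mem_nhds s hδ) hμ]
  rintro ⟨s', ν⟩ ⟨hs', hν⟩
  refine (dist_triangle _ (∫ ω, bar (shift s f) ω ∂ν.measure) _).trans_lt ?_
  have h1 : dist (∫ ω, bar (shift s' f) ω ∂ν.measure) (∫ ω, bar (shift s f) ω ∂ν.measure)
      ≤ ε / 2 := by
    refine abs_integral_sub_integral_le ν (barMap (shift s' f)) (barMap (shift s f)) fun ω => ?_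
    rw [Real.dist_eq, ← ContinuousMap.sub_apply, ← map_sub]
    exact (abs_bar_le _ ω).trans (hshift s' s hs')
  have h2 : dist (∫ ω, bar (shift s f) ω ∂ν.measure) (∫ ω, bar (shift s f) ω ∂μ.measure)
      < ε / 2 := hν
  linarith

/-- The flow `T_s^*` on `P(Ω*)`. -/
def translationFlow : Flow ℝ PStar where
  toFun := pushStar
  cont' := PStar.continuous_of_denseRange denseRange_barMap fun f => by
    simp only [Function.uncurry, barMap_apply, integral_bar_pushStar]
    exact continuous_integral_bar_shift f
  map_add' s s' μ := PStar.ext_of_denseRange denseRange_barMap fun f => by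
    simp only [barMap_apply, integral_bar_pushStar, bar_shift_shift, add_comm s s']
  map_zero' μ := PStar.ext_of_denseRange denseRange_barMap fun f => by
    simp only [barMap_apply, integral_bar_pushStar, bar_shift_zero]

theorem integral_bar_translationFlow (s : ℝ) (μ : PStar) (f : Cub) :
    ∫ ω, bar f ω ∂(translationFlow s μ).measure = ∫ ω, bar (shift s f) ω ∂μ.measure :=
  integral_bar_pushStar s μ f

theorem isTranslationFlow_translationFlow : IsTranslationFlow translationFlow := fun s μ f => by
  rw [integral_bar_translationFlow, shift_coe]

/-- For s ≤ 0 the time-s map is the inverse of the time-(-s) map, so nonnegative times determine the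
flow. -/
theorem flow_ext_of_nonneg {α : Type*} [TopologicalSpace α] {φ ψ : Flow ℝ α}
    (h : ∀ (s : ℝ≥0) (x : α), φ s x = ψ s x) : φ = ψ := by
  refine Flow.ext fun s x => ?_
  rcases le_total 0 s with hs | hs
  · exact h ⟨s, hs⟩ x
  · have h1 : φ (-s) (φ s x) = ψ (-s) (φ s x) := h ⟨-s, neg_nonneg.mpr hs⟩ _
    have h2 := congrArg (ψ s) h1
    rw [← φ.map_add, ← ψ.map_add, neg_add_cancel, add_neg_cancel, φ.map_zero, ψ.map_zero] at h2
    exact h2.symm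

theorem IsTranslationFlow.eq {T : Flow ℝ PStar} (hT : IsTranslationFlow T) :
    T = translationFlow :=
  flow_ext_of_nonneg fun s μ => PStar.ext_of_denseRange denseRange_barMap fun f =>
    (hT s μ f).trans (isTranslationFlow_translationFlow s μ f).symm

theorem IsDilationFlow.eq {P P' : Flow ℝ M} (hP : IsDilationFlow P) (hP' : IsDilationFlow P') :
    P = P' :=
  flow_ext_of_nonneg fun s ψ => Subtype.ext <| DFunLike.ext _ _ fun f =>
    (hP s ψ f).trans (hP' s ψ f).symm

/-! ### The isomorphism of `P(Ω*)` and `ℳ` -/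

theorem tendsto_twoPow : Tendsto twoPow atTop atTop := by
  rw [tendsto_Ici_atTop]
  refine (tendsto_rpow_atTop_of_base_gt_one 2 (by norm_num)).comp ?_
  rw [atTop_Ici_eq]
  exact tendsto_comap

theorem map_twoPow_le_atTop (ω : OmegaStar) :
    (ω.1.toUltrafilter.map twoPow : Filter HalfLine) ≤ atTop :=
  tendsto_twoPow.mono_left ω.le_atTop

theorem psi_le_limsup (ω : OmegaStar) (f : LInf) : psi ω f ≤ limsup (mean f) atTop :=
  psiU_le_limsup (map_twoPow_le_atTop ω) f

/-- The functional `f ↦ ∫ psi ω f dμ(ω)`. -/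
def integralPsi (μ : PStar) : WeakDual ℝ LInf :=
  StrongDual.toWeakDual <| LinearMap.mkContinuous
    { toFun := fun f => ∫ ω, psiMap f ω ∂μ.measure
      map_add' := fun f g => by
        rw [← integral_add (integrable_continuousMap μ _) (integrable_continuousMap μ _), map_add]
        rfl
      map_smul' := fun c f => by
        rw [RingHom.id_apply, smul_eq_mul, ← integral_const_mul, map_smul]
        rfl } 1 fun f => by
    have h := norm_integral_le_of_norm_le_const (μ := μ.measure)
      (Eventually.of_forall fun ω => norm_psi_le f ω)
    simpa using h

theorem integralPsi_apply (μ : PStar) (f : LInf) :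
    integralPsi μ f = ∫ ω, psiMap f ω ∂μ.measure := rfl

theorem integralPsi_mem (μ : PStar) : integralPsi μ ∈ M := fun f => by
  rw [integralPsi_apply]
  have h := integral_mono (integrable_continuousMap μ (psiMap f))
    (integrable_const (limsup (mean f) atTop)) fun ω => by
      rw [psiMap_apply]
      exact psi_le_limsup ω f
  simpa using h

theorem iSup_continuousMap_add_le (g g' : C(OmegaStar, ℝ)) :
    ⨆ ω, (g + g') ω ≤ (⨆ ω, g ω) + ⨆ ω, g' ω :=
  ciSup_le fun ω => add_le_add (le_ciSup (isCompact_range g.continuous).bddAbove ω)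
    (le_ciSup (isCompact_range g'.continuous).bddAbove ω)

theorem apply_le_iSup_psi {ψ : WeakDual ℝ LInf} (hψ : ψ ∈ M) (f : LInf) :
    ψ f ≤ ⨆ ω, psiMap f ω :=
  (hψ f).trans (limsup_mean_le fun ω => by
    rw [← psiMap_apply]
    exact le_ciSup (isCompact_range (psiMap f).continuous).bddAbove ω)

theorem exists_integralPsi_eq {ψ : WeakDual ℝ LInf} (hψ : ψ ∈ M) :
    ∃ μ : PStar, integralPsi μ = ψ := by
  -- A linear section of `psiMap` over its range; `hψ0` shows that ψ does not depend on the choice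
  -- of preimage.
  obtain ⟨σ, hσ⟩ := psiMap.rangeRestrict.exists_rightInverse_of_surjective
    psiMap.range_rangeRestrict
  have hσ' : ∀ x, psiMap (σ x) = x := fun x => congrArg Subtype.val (LinearMap.congr_fun hσ x)
  have hψ0 : ∀ f f', psiMap f = psiMap f' → ψ f ≤ ψ f' := fun f f' h => by
    have h1 := apply_le_iSup_psi hψ (f - f')
    rw [map_sub, map_sub, h, sub_self] at h1
    simpa using h1
  let φ : C(OmegaStar, ℝ) →ₗ.[ℝ] ℝ := ⟨psiMap.range, (WeakDual.toStrongDual ψ).toLinearMap ∘ₗ σ⟩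
  obtain ⟨L, hL, hLN⟩ := exists_extension_of_le_sublinear φ (fun g => ⨆ ω, g ω)
    (fun c hc g => (Real.mul_iSup_of_nonneg hc.le _).symm) iSup_continuousMap_add_le fun x => by
      have := apply_le_iSup_psi hψ (σ x)
      rwa [hσ'] at this
  -- Domination by the supremum yields positivity when tested on -g, and normalization when tested
  -- on 1 and -1.
  obtain ⟨μ, hμ⟩ := exists_pstar_of_functional L (fun g hg => by
    have h1 := (hLN (-g)).trans (ciSup_le fun ω => neg_nonpos.mpr (hg ω))
    rw [map_neg] at h1
    linarith) (le_antisymm (by simpa using hLN 1) (by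
      have h1 := hLN (-1)
      rw [map_neg] at h1
      simp only [ContinuousMap.neg_apply, ContinuousMap.one_apply, ciSup_const] at h1
      linarith))
  refine ⟨μ, DFunLike.ext _ _ fun f => ?_⟩
  rw [integralPsi_apply, hμ, hL ⟨psiMap f, f, rfl⟩]
  have h := hσ' ⟨psiMap f, f, rfl⟩
  exact le_antisymm (hψ0 _ _ h) (hψ0 _ _ h.symm)

theorem bijective_integralPsi :
    Function.Bijective fun μ : PStar => (⟨integralPsi μ, integralPsi_mem μ⟩ : M) := by
  refine ⟨fun μ ν h => ?_, fun ψ => ?_⟩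
  · exact PStar.ext_of_denseRange denseRange_psiMap fun f =>
      congrArg (fun ψ : M => ψ.1 f) h
  · obtain ⟨μ, hμ⟩ := exists_integralPsi_eq ψ.2
    exact ⟨μ, Subtype.ext hμ⟩

/-- The homeomorphism of `P(Ω*)` onto `ℳ`. -/
def psiHomeo : PStar ≃ₜ M where
  toEquiv := Equiv.ofBijective _ bijective_integralPsi
  continuous_toFun := Continuous.subtype_mk (WeakDual.continuous_of_continuous_eval fun f =>
    PStar.continuous_integral (psiMap f)) _
  -- Convergence in P(Ω*) need only be tested on the dense functions `psiMap f`, whose integrals are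
  -- the evaluations ψ(f).
  continuous_invFun := PStar.continuous_of_denseRange denseRange_psiMap fun f => by
    have h : ∀ ψ : M, ∫ ω, psiMap f ω
        ∂((Equiv.ofBijective _ bijective_integralPsi).symm ψ).measure = ψ.1 f := fun ψ =>
      congrArg (fun ψ : M => ψ.1 f) ((Equiv.ofBijective _ bijective_integralPsi).apply_symm_apply ψ)
    exact ((WeakDual.eval_continuous f).comp continuous_subtype_val).congr fun ψ => (h ψ).symm

theorem psiHomeo_apply (μ : PStar) (f : LInf) :
    (psiHomeo μ).1 f = ∫ ω, psi ω f ∂μ.measure := by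
  simp only [← psiMap_apply]
  rfl

theorem integrable_psi (μ : PStar) (f : LInf) : Integrable (fun ω => psi ω f) μ.measure := by
  simp only [← psiMap_apply]
  exact integrable_continuousMap μ (psiMap f)

theorem psiHomeo_isMix {a b : ℝ} {μ ν ρ : PStar} (h : IsMix a b μ ν ρ) (ha : 0 ≤ a)
    (hb : 0 ≤ b) : (psiHomeo ρ).1 = a • (psiHomeo μ).1 + b • (psiHomeo ν).1 :=
  DFunLike.ext _ _ fun f => h.integral_eq ha hb (psiMap f)

theorem psiHomeo_diracStar (ω : OmegaStar) (f : LInf) :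
    (psiHomeo (diracStar ω)).1 f = psi ω f := by
  rw [← psiMap_apply]
  exact integral_diracStar ω (psiMap f)

/-- The flow `P_s^*` on `ℳ`. -/
def dilationFlow : Flow ℝ M where
  -- P_s forgets the values on [1, 2^s) and has no inverse on L^∞; conjugation supplies the negative
  -- times.
  toFun s ψ := psiHomeo (translationFlow s (psiHomeo.symm ψ))
  cont' := psiHomeo.continuous.comp
    (translationFlow.continuous continuous_fst (psiHomeo.symm.continuous.comp continuous_snd))
  map_add' s s' ψ := by rw [psiHomeo.symm_apply_apply, translationFlow.map_add]
  map_zero' ψ := by rw [translationFlow.map_zero, id, psiHomeo.apply_symm_apply]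

theorem dilationFlow_apply (s : ℝ) (ψ : M) :
    dilationFlow s ψ = psiHomeo (translationFlow s (psiHomeo.symm ψ)) := rfl

theorem isDilationFlow_dilationFlow : IsDilationFlow dilationFlow := fun s ψ f => by
  obtain ⟨μ, rfl⟩ := psiHomeo.surjective ψ
  rw [dilationFlow_apply, psiHomeo.symm_apply_apply, psiHomeo_apply, psiHomeo_apply]
  simp only [psi_dilate, psi_eq_bar _ f]
  exact isTranslationFlow_translationFlow s μ (expMean f)

/-! ### Closed convex hulls -/

theorem isClosed_M : IsClosed M := by
  simp only [M, ofPred_forall]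
  exact isClosed_iInter fun f => isClosed_le (WeakDual.eval_continuous f) continuous_const

theorem convex_M : Convex ℝ M := by
  intro ψ hψ φ hφ a b ha hb hab f
  calc (a • ψ + b • φ) f = a * ψ f + b * φ f := rfl
    _ ≤ a * limsup (mean f) atTop + b * limsup (mean f) atTop :=
        add_le_add (mul_le_mul_of_nonneg_left (hψ f) ha) (mul_le_mul_of_nonneg_left (hφ f) hb)
    _ = limsup (mean f) atTop := by rw [← add_mul, hab, one_mul]

/-- A point of ℳ outside C would be strictly separated from C by evaluation at some f. But ψ_ω(f) ≤
u for all ω forces the limsup of the means, hence every element of ℳ, to be at most u at f. -/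
theorem M_subset_of_isClosed_convex {C : Set (WeakDual ℝ LInf)} (hcv : Convex ℝ C)
    (hcl : IsClosed C) (h : ∀ ω, (psiHomeo (diracStar ω)).1 ∈ C) : M ⊆ C := by
  intro φ hφ
  by_contra hφC
  have : LocallyConvexSpace ℝ (WeakDual ℝ LInf) :=
    inferInstanceAs (LocallyConvexSpace ℝ (WeakBilin (topDualPairing ℝ LInf)))
  obtain ⟨F, u, hFC, hFφ⟩ := geometric_hahn_banach_closed_point hcv hcl hφC
  obtain ⟨f, hf⟩ := LinearMap.dualEmbedding_surjective (topDualPairing ℝ LInf) F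
  have hF : ∀ ψ : WeakDual ℝ LInf, F ψ = ψ f := fun ψ => by
    rw [← hf]
    rfl
  have h1 : φ f ≤ u := (hφ f).trans (limsup_mean_le fun ω => by
    have := hFC _ (h ω)
    rw [hF, psiHomeo_diracStar] at this
    exact this.le)
  rw [hF] at hFφ
  linarith

theorem le_atTop_iff_forall_isBounded (𝒰 : Ultrafilter HalfLine) :
    (𝒰 : Filter HalfLine) ≤ atTop ↔ ∀ B : Set HalfLine, Bornology.IsBounded B → B ∉ 𝒰 := by
  have hdist : ∀ x : HalfLine, dist x ⟨1, mem_Ici.mpr le_rfl⟩ = (x : ℝ) - 1 := fun x => by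
    rw [Subtype.dist_eq, Real.dist_eq, abs_of_nonneg (sub_nonneg.mpr x.2)]
  rw [atTop_Ici_eq, ← tendsto_iff_comap, tendsto_atTop]
  constructor
  · intro h B hB hmem
    obtain ⟨r, hr⟩ := hB.subset_closedBall (⟨1, mem_Ici.mpr le_rfl⟩ : HalfLine)
    obtain ⟨x, hx1, hx2⟩ := Ultrafilter.nonempty_of_mem (Filter.inter_mem (h (r + 2)) hmem)
    have h1 := Metric.mem_closedBall.mp (hr hx2)
    rw [hdist] at h1
    have h2 : r + 2 ≤ (x : ℝ) := hx1
    linarith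
  · intro h c
    have hB : Bornology.IsBounded {x : HalfLine | (x : ℝ) < c} :=
      Metric.isBounded_closedBall.subset fun x (hx : (x : ℝ) < c) =>
        Metric.mem_closedBall.mpr ((hdist x).le.trans (sub_le_sub_right hx.le 1))
    filter_upwards [Ultrafilter.compl_mem_iff_notMem.mpr (h _ hB)] with x hx
    exact not_lt.mp hx

theorem Mtilde_subset_M : Mtilde ⊆ M := by
  rintro ψ ⟨𝒰, h𝒰, hψ⟩ f
  rw [hψ]
  exact psiU_le_limsup ((le_atTop_iff_forall_isBounded 𝒰).mpr h𝒰) f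

theorem psiHomeo_diracStar_mem_Mtilde (ω : OmegaStar) : (psiHomeo (diracStar ω)).1 ∈ Mtilde :=
  ⟨ω.1.toUltrafilter.map twoPow, (le_atTop_iff_forall_isBounded _).mp (map_twoPow_le_atTop ω),
    fun f => psiHomeo_diracStar ω f⟩

theorem closure_convexHull_Mtilde : closure (convexHull ℝ Mtilde) = M := by
  refine (closure_minimal (convexHull_min Mtilde_subset_M convex_M) isClosed_M).antisymm ?_
  exact M_subset_of_isClosed_convex (convex_convexHull ℝ Mtilde).closure isClosed_closure
    fun ω => subset_closure (subset_convexHull ℝ _ (psiHomeo_diracStar_mem_Mtilde ω))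

/-- `PStar` carries no vector space structure, so the hull is expressed by minimality. The image of
S in the dual is closed and convex and contains every ψ_ω, so it contains ℳ, and injectivity brings
this back to S. -/
theorem eq_univ_of_isClosed_of_isMix {S : Set PStar} (hcl : IsClosed S)
    (hmix : ∀ μ ∈ S, ∀ ν ∈ S, ∀ (ρ : PStar) (a b : ℝ), 0 ≤ a → 0 ≤ b → a + b = 1 →
      IsMix a b μ ν ρ → ρ ∈ S) (hdirac : ∀ ω, diracStar ω ∈ S) : S = univ := by
  have hC : M ⊆ (fun μ => (psiHomeo μ).1) '' S := by
    refine M_subset_of_isClosed_convex ?_ ?_ fun ω => ⟨_, hdirac ω, rfl⟩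
    · rintro _ ⟨μ, hμ, rfl⟩ _ ⟨ν, hν, rfl⟩ a b ha hb hab
      obtain ⟨ρ, hρ⟩ := exists_isMix μ ν ha hb hab
      exact ⟨ρ, hmix μ hμ ν hν ρ a b ha hb hab hρ, psiHomeo_isMix hρ ha hb⟩
    · exact (isClosed_M.isClosedEmbedding_subtypeVal.isClosedMap.comp psiHomeo.isClosedMap) S hcl
  refine eq_univ_of_forall fun μ => ?_
  obtain ⟨ν, hν, h⟩ := hC (psiHomeo μ).2
  rwa [← psiHomeo.injective (Subtype.ext h)]

end CesaroFlow

end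

open MeasureTheory CesaroFlow in
theorem theorem4p4 :
    (∃! T : Flow ℝ PStar, IsTranslationFlow T) ∧
    (∃! P : Flow ℝ M, IsDilationFlow P) ∧
    ∃ Psi : PStar ≃ₜ M,
      (∀ (μ : PStar) (f : LInf), Integrable (fun ω => psi ω f) μ.measure ∧
        (Psi μ).1 f = ∫ ω, psi ω f ∂μ.measure) ∧
      (∀ (a b : ℝ) (μ ν : PStar), 0 ≤ a → 0 ≤ b → a + b = 1 →
        ∃ ρ : PStar, IsMix a b μ ν ρ ∧ (Psi ρ).1 = a • (Psi μ).1 + b • (Psi ν).1) ∧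
      (∀ (T : Flow ℝ PStar) (P : Flow ℝ M), IsTranslationFlow T → IsDilationFlow P →
        ∀ (s : ℝ) (μ : PStar), Psi (T s μ) = P s (Psi μ)) ∧
      (∀ (η : NStar) (t : unitInterval), ∃ δ : PStar,
        δ.measure = Measure.dirac (point η t) ∧
        (∀ f : LInf, (Psi δ).1 f = psi (point η t) f) ∧
        ∀ T : Flow ℝ PStar, IsTranslationFlow T →
          ∀ s : ℝ, (T s δ).measure = Measure.dirac (tauFlow s η t)) ∧
      closure (convexHull ℝ Mtilde) = M ∧
      (∀ S : Set PStar, IsClosed S →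
        (∀ μ ∈ S, ∀ ν ∈ S, ∀ (ρ : PStar) (a b : ℝ), 0 ≤ a → 0 ≤ b → a + b = 1 →
          IsMix a b μ ν ρ → ρ ∈ S) →
        (∀ (ω : OmegaStar) (δ : PStar), δ.measure = Measure.dirac ω → δ ∈ S) →
        S = Set.univ) := by
  refine ⟨⟨translationFlow, isTranslationFlow_translationFlow, fun T hT => hT.eq⟩,
    ⟨dilationFlow, isDilationFlow_dilationFlow, fun P hP => hP.eq isDilationFlow_dilationFlow⟩,
    psiHomeo, fun μ f => ⟨integrable_psi μ f, psiHomeo_apply μ f⟩, ?_, ?_, ?_,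
    closure_convexHull_Mtilde, ?_⟩
  · intro a b μ ν ha hb hab
    obtain ⟨ρ, hρ⟩ := exists_isMix μ ν ha hb hab
    exact ⟨ρ, hρ, psiHomeo_isMix hρ ha hb⟩
  · intro T P hT hP s μ
    rw [hT.eq, hP.eq isDilationFlow_dilationFlow, dilationFlow_apply, psiHomeo.symm_apply_apply]
  · intro η t
    refine ⟨diracStar (point η t), rfl, psiHomeo_diracStar _, fun T hT s => ?_⟩
    rw [hT.eq, ← flowStar_point]
    exact Measure.map_dirac' (continuous_flowStar s).measurable _
  · intro S hcl hmix hdirac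
    exact eq_univ_of_isClosed_of_isMix hcl hmix fun ω => hdirac ω _ rfl
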